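/- Let $f,g:\mathbb R\to\mathbb R$ be bounded (or only essentially bounded) measurable functions, let $P=-i\,d/dx$ and let $Q$ be multiplication by $x$ in $L^2(\mathbb R)$. Suppose that the commutator $C=i[f(P),g(Q)]$ is positive ($C\ge 0$), non-zero and of finite rank. Then $f$ and $g$ can be modified on sets of Lebesgue measure zero so that $f,g\in C^1(\mathbb R)$, the derivatives $f'$ and $g'$ vanish nowhere, and $f'$ and $g'$ belong to the Schwartz space $\mathcal S(\mathbb R)$. Moreover, $C$ has an integral kernel of the form $K(x,y)=\sum_{j=1}^N\phi_j(x)\overline{\phi_j(y)}$ with linearly independent $\phi_1,\dots,\phi_N\in L^2(\mathbb R)$; the limits of (the modified) $f$ and $g$ at $\pm\infty$ exist and $[f]=f(\infty)-f(-\infty)$, $[g]=g(\infty)-g(-\infty)$ are non-zero; and for every such representation of the kernel, the $\phi_j$ and their Fourier transforms $\widehat{\phi_j}(\xi)=(2\pi)^{-1/2}\int e^{-i\xi x}\phi_j(x)\,dx$ (taken in the $L^2$ sense) have continuous versions, with which, for all $x,\xi\in\mathbb R$, $$g'(x)=\frac{2\pi}{[f]}\sum_{j=1}^N|\phi_j(x)|^2,\qquad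 f'(\xi)=\frac{2\pi}{[g]}\sum_{j=1}^N|\widehat{\phi_j}(\xi)|^2 .$$ -/

import Mathlib

open MeasureTheory Filter Topology
open scoped ENNReal SchwartzMap FourierTransform ComplexConjugate

noncomputable section

/-- The Hilbert space `L²(ℝ)` of complex-valued functions. -/
abbrev L2R : Type := Lp (α := ℝ) ℂ 2 (volume : Measure ℝ)

/-- Multiplication by an essentially bounded measurable function `m`, as a bounded operator
on `L²(ℝ)`. -/
def mulOp (m : ℝ → ℂ) (hm : MemLp m ∞ (volume : Measure ℝ)) : L2R →L[ℂ] L2R :=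
  (ContinuousLinearMap.mul ℂ ℂ).holderL volume ∞ 2 2 (hm.toLp m)

theorem coeFn_mulOp (m : ℝ → ℂ) (hm : MemLp m ∞ (volume : Measure ℝ)) (ψ : L2R) :
    mulOp m hm ψ =ᵐ[volume] fun x => m x * ψ x := by
  have h1 : mulOp m hm ψ =ᵐ[volume] fun x => (hm.toLp m) x * ψ x :=
    (ContinuousLinearMap.mul ℂ ℂ).coeFn_holder (r := 2) (hm.toLp m) ψ
  filter_upwards [h1, hm.coeFn_toLp] with x hx hx'
  rw [hx, hx']

theorem memLp_top_dilate {f : ℝ → ℝ} (hf : MemLp f ∞ (volume : Measure ℝ)) :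
    MemLp (fun w : ℝ => ((f (2 * Real.pi * w) : ℝ) : ℂ)) ∞ (volume : Measure ℝ) := by
  have h2 : (2 * Real.pi : ℝ) ≠ 0 := by positivity
  have h : MemLp f ∞ (Measure.map (fun w : ℝ => 2 * Real.pi * w) volume) := by
    rw [Real.map_volume_mul_left h2]
    exact hf.smul_measure ENNReal.ofReal_ne_top
  exact (h.comp_of_map (by fun_prop)).ofReal

/-- `g(Q)`: multiplication by the real function `g`, where `Q` is multiplication by `x`. -/
def funQ (g : ℝ → ℝ) (hg : MemLp g ∞ (volume : Measure ℝ)) : L2R →L[ℂ] L2R :=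
  mulOp (fun x => (g x : ℂ)) hg.ofReal

/-- `f(P)` for `P = -i d/dx`. In the normalization of `𝓕` used here,
`(𝓕 ψ) w = ∫ e^{-2πiwx} ψ x dx`, the operator `P` is multiplication by `2πw` on the Fourier
side, so that `f(P) = 𝓕⁻¹ f(2πw) 𝓕`. -/
def funP (f : ℝ → ℝ) (hf : MemLp f ∞ (volume : Measure ℝ)) : L2R →L[ℂ] L2R :=
  ((Lp.fourierTransformₗᵢ ℝ ℂ).symm : L2R →L[ℂ] L2R) ∘L
    mulOp (fun w => ((f (2 * Real.pi * w) : ℝ) : ℂ)) (memLp_top_dilate hf) ∘L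
    ((Lp.fourierTransformₗᵢ ℝ ℂ) : L2R →L[ℂ] L2R)

/-- The commutator `i[f(P), g(Q)]`. -/
def commPQ (f g : ℝ → ℝ) (hf : MemLp f ∞ (volume : Measure ℝ))
    (hg : MemLp g ∞ (volume : Measure ℝ)) : L2R →L[ℂ] L2R :=
  Complex.I • (funP f hf ∘L funQ g hg - funQ g hg ∘L funP f hf)

/-- `T` is the integral operator with kernel `K`. -/
def HasIntegralKernel (T : L2R →L[ℂ] L2R) (K : ℝ → ℝ → ℂ) : Prop :=
  ∀ ψ : L2R, (∀ᵐ x, Integrable (fun y => K x y * ψ y)) ∧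
    T ψ =ᵐ[volume] fun x => ∫ y, K x y * ψ y

/-- The unitary Fourier transform `φ̂(ξ) = (2π)^{-1/2} ∫ e^{-iξx} φ(x) dx` on `L²(ℝ)`,
as a function defined almost everywhere. -/
def unitaryFT (φ : L2R) : ℝ → ℂ :=
  fun ξ => ((Real.sqrt (2 * Real.pi))⁻¹ : ℝ) * (Lp.fourierTransformₗᵢ ℝ ℂ φ) (ξ / (2 * Real.pi))

end

/-! Diagonalizing the finite-rank positive commutator writes it as `∑ ⟨φⱼ, ·⟩ φⱼ`, with kernel
`K(x,y) = ∑ φⱼ(x) conj (φⱼ(y))`. Formally the kernel of `i[f(P), g(Q)]` is a function of `x - y`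
times `g(x) - g(y)`; everything follows from this factorization and from its dual on the Fourier
side.

Since `f` is only bounded, its Fourier transform is not a function, and the factorization has to be
obtained without it. Matrix elements on modulated cutoffs `e^{2πiξx} p(x)` express `H_p = ∑ |𝓕(p
φⱼ)|²` as a correlation of `F(w) = f(2πw)` with an integrable function built from `p` and `g`.
Comparing two cutoffs eliminates `F` (`IsCommRep.cutoff_comm`). Interval cutoffs and a vanishing
shift make `g` an affine function of the primitive of `κ = ∑ |φⱼ|²` (`IsCommRep.exists_primitive`).
So `g` is continuous with limits at `±∞`; letting one cutoff tend to `1` then gives `(x - y)[g]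
K(x,y) = Γ(x - y)(g(x) - g(y))`, where `Γ(s) = ∫ K(x+s,x) dx` (`IsCommRep.sumKernel_ae`).

By linear independence each `φᵢ` is `∫ K(·,y) χᵢ(y) dy` with `χᵢ` supported in a bounded set away
from a given point. The factor `1/(x - y)` is harmless there, so `φᵢ` is continuous; it also gains a
power of decay at infinity over `Γ`. Decay of the `φⱼ` returns as decay of `Γ`, and iteration makes
both rapid (`integrable_weight_density`). A zero of `κ` would make `g` locally constant and spread
to all of `ℝ` (`density_pos`).

The hypothesis is invariant under the Fourier transform, which exchanges `f` and `g` up to a sign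
and a reflection (`IsCommRep.dual`). So `f` is equally regular, with density `∑ |φ̂ⱼ|²`. The Fourier
transform of `κ` is the function `Γ` of the dual problem, hence rapidly decreasing; as `κ` is so
too, it is Schwartz (`exists_schwartz_of_rapidDecay`). The constants follow by differentiating the
correlation formula for `H_p` in `ξ` (`IsCommRep.mul_jump`) and from Plancherel. -/

/-! ### The Fourier transform on `L²` and as an integral. -/

/-- The Fourier transform on `L²(ℝ)`. -/
noncomputable abbrev FT2 : L2R ≃ₗᵢ[ℂ] L2R := Lp.fourierTransformₗᵢ ℝ ℂ

theorem integral_schwartz_mul_FT2 (φ : L2R) (η : 𝓢(ℝ, ℂ)) :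
    ∫ x, η x * FT2 φ x = ∫ x, 𝓕 (η : ℝ → ℂ) x * φ x := by
  have h := congrArg (fun T : 𝓢'(ℝ, ℂ) => T η) (Lp.fourier_toTemperedDistribution_eq φ)
  simp only [TemperedDistribution.fourier_apply, Lp.toTemperedDistribution_apply] at h
  simp only [smul_eq_mul, SchwartzMap.fourier_coe] at h
  exact h.symm

theorem continuous_fourier {m : ℝ → ℂ} (h1 : Integrable m) : Continuous (𝓕 m) :=
  VectorFourier.fourierIntegral_continuous Real.continuous_fourierChar (by fun_prop) h1

/-- By the multiplication formula both sides have the same integrals against smooth compactly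
supported functions. -/
theorem FT2_toLp {m : ℝ → ℂ} (h1 : Integrable m) (h2 : MemLp m 2) :
    FT2 (h2.toLp m) =ᵐ[volume] 𝓕 m := by
  have hc : Continuous (𝓕 m) := continuous_fourier h1
  apply ae_eq_of_integral_contDiff_smul_eq
  · exact (Lp.memLp _).locallyIntegrable (by norm_num)
  · exact hc.locallyIntegrable
  intro g g_smooth g_cpt
  have hg₁ : HasCompactSupport (Complex.ofRealCLM ∘ g) := g_cpt.comp_left rfl
  have hg₂ : ContDiff ℝ ((⊤ : ℕ∞) : WithTop ℕ∞) (Complex.ofRealCLM ∘ g) :=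
    Complex.ofRealCLM.contDiff.comp g_smooth
  have h := integral_schwartz_mul_FT2 (h2.toLp m) (hg₁.toSchwartzMap hg₂)
  have e1 : ∀ x, (hg₁.toSchwartzMap hg₂) x = (g x : ℂ) := fun x => rfl
  have e2 : ∫ x, 𝓕 (hg₁.toSchwartzMap hg₂ : ℝ → ℂ) x * (h2.toLp m) x
      = ∫ x, 𝓕 (hg₁.toSchwartzMap hg₂ : ℝ → ℂ) x • m x := by
    apply integral_congr_ae
    filter_upwards [h2.coeFn_toLp] with x hx
    rw [hx, smul_eq_mul]
  have e3 := VectorFourier.integral_fourierIntegral_smul_eq_flip (L := innerₗ ℝ)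
    (μ := (volume : Measure ℝ)) (ν := (volume : Measure ℝ)) Real.continuous_fourierChar
    (by fun_prop) (hg₁.toSchwartzMap hg₂).integrable h1
  rw [flip_innerₗ] at e3
  have e4 : ∫ x, 𝓕 (hg₁.toSchwartzMap hg₂ : ℝ → ℂ) x • m x
    = ∫ x, (hg₁.toSchwartzMap hg₂) x • 𝓕 m x := e3
  rw [e2, e4] at h
  simpa [e1] using h

theorem fourier_fourier_schwartz (η : 𝓢(ℝ, ℂ)) (x : ℝ) : 𝓕 (𝓕 η) x = η (-x) := by
  have h : 𝓕⁻ (𝓕 η) = η := by simp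
  have h2 := congrArg (fun ψ : 𝓢(ℝ, ℂ) => ψ (-x)) h
  rw [← h2, SchwartzMap.fourierInv_coe, Real.fourierInv_eq_fourier_neg, neg_neg]
  rfl

/-- The reflection `φ ↦ φ(-·)` on `L²(ℝ)`. -/
noncomputable def reflectL2 : L2R →ₗᵢ[ℂ] L2R :=
  Lp.compMeasurePreservingₗᵢ ℂ (fun x : ℝ => -x) (Measure.measurePreserving_neg volume)

theorem coeFn_reflectL2 (φ : L2R) : reflectL2 φ =ᵐ[volume] fun x => φ (-x) :=
  Lp.coeFn_compMeasurePreserving φ (Measure.measurePreserving_neg volume)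

theorem FT2_FT2 (φ : L2R) : FT2 (FT2 φ) = reflectL2 φ := by
  apply DenseRange.induction_on (p := fun φ : L2R => FT2 (FT2 φ) = reflectL2 φ)
    (SchwartzMap.denseRange_toLpCLM (p := 2) (F := ℂ) (μ := (volume : Measure ℝ)) ENNReal.ofNat_ne_top) φ
  · exact isClosed_eq (by fun_prop) (by fun_prop)
  · intro η
    have h1 : FT2 (FT2 (η.toLp 2)) = (𝓕 (𝓕 η)).toLp 2 := by
      change 𝓕 (𝓕 (η.toLp 2)) = _
      rw [SchwartzMap.toLp_fourier_eq, SchwartzMap.toLp_fourier_eq]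
    rw [SchwartzMap.toLpCLM_apply, h1]
    apply Lp.ext
    have hq := (Measure.measurePreserving_neg (volume : Measure ℝ)).quasiMeasurePreserving.ae
      (η.coeFn_toLp 2 volume)
    filter_upwards [SchwartzMap.coeFn_toLp (𝓕 (𝓕 η)) 2 volume, coeFn_reflectL2 (η.toLp 2), hq]
      with x hx hx2 hx3
    rw [hx, hx2, hx3, fourier_fourier_schwartz]

theorem FT2_FT2_ae (φ : L2R) : FT2 (FT2 φ) =ᵐ[volume] fun x => φ (-x) := by
  rw [FT2_FT2]; exact coeFn_reflectL2 φ

theorem inner_L2R (φ ψ : L2R) : inner ℂ φ ψ = ∫ x, conj (φ x) * ψ x := by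
  rw [L2.inner_def]
  simp [RCLike.inner_apply, mul_comm]

theorem integrable_conj_mul {m n : ℝ → ℂ} (hm : MemLp m 2) (hn : MemLp n 2) :
    Integrable (fun x => conj (m x) * n x) := by
  have := hm.star.integrable_mul hn
  exact this

theorem memLp_fourier {m : ℝ → ℂ} (h1 : Integrable m) (h2 : MemLp m 2) : MemLp (𝓕 m) 2 :=
  (memLp_congr_ae (FT2_toLp h1 h2)).1 (Lp.memLp _)

theorem integral_conj_fourier_mul_fourier {m n : ℝ → ℂ} (hm1 : Integrable m) (hm2 : MemLp m 2)
    (hn1 : Integrable n) (hn2 : MemLp n 2) :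
    ∫ t, conj (𝓕 m t) * 𝓕 n t = ∫ x, conj (m x) * n x := by
  have h := FT2.inner_map_map (hm2.toLp m) (hn2.toLp n)
  rw [inner_L2R, inner_L2R] at h
  have e1 : ∫ x, conj (FT2 (hm2.toLp m) x) * FT2 (hn2.toLp n) x
      = ∫ t, conj (𝓕 m t) * 𝓕 n t := by
    apply integral_congr_ae
    filter_upwards [FT2_toLp hm1 hm2, FT2_toLp hn1 hn2] with x h1 h2
    rw [h1, h2]
  have e2 : ∫ x, conj (hm2.toLp m x) * hn2.toLp n x = ∫ t, conj (m t) * n t := by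
    apply integral_congr_ae
    filter_upwards [hm2.coeFn_toLp, hn2.coeFn_toLp] with x h1 h2
    rw [h1, h2]
  rw [← e1, ← e2, h]

theorem fourier_comp_sub (n : ℝ → ℂ) (s t : ℝ) :
    𝓕 (fun x => n (x - s)) t = Real.fourierChar (-(s * t)) * 𝓕 n t := by
  rw [Real.fourier_real_eq, Real.fourier_real_eq, ← integral_const_mul,
    ← integral_add_right_eq_self _ s]
  congr 1; ext v
  simp only [add_sub_cancel_right, Circle.smul_def, smul_eq_mul]
  rw [← mul_assoc, ← Circle.coe_mul, ← AddChar.map_add_eq_mul]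
  congr 3; ring

/-- Parseval's formula with a modulation. -/
theorem fourier_conj_fourier_mul_fourier {m n : ℝ → ℂ} (hm1 : Integrable m) (hm2 : MemLp m 2)
    (hn1 : Integrable n) (hn2 : MemLp n 2) (s : ℝ) :
    𝓕 (fun t => conj (𝓕 m t) * 𝓕 n t) s = ∫ x, conj (m x) * n (x - s) := by
  have hs := measurePreserving_sub_right (volume : Measure ℝ) s
  have hn1' : Integrable (fun x => n (x - s)) := hn1.comp_sub_right s
  have hn2' : MemLp (fun x => n (x - s)) 2 := hn2.comp_measurePreserving hs
  rw [← integral_conj_fourier_mul_fourier hm1 hm2 hn1' hn2', Real.fourier_real_eq]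
  congr 1; ext t
  rw [fourier_comp_sub, Circle.smul_def, smul_eq_mul, mul_comm s t]
  ring

/-! ### Correlations with a bounded symbol. -/

theorem memLp_top_bound {F : ℝ → ℂ} (hF : MemLp F ∞ (volume : Measure ℝ)) :
    ∃ C : ℝ, ∀ᵐ x, ‖F x‖ ≤ C := by
  refine ⟨(eLpNormEssSup F volume).toReal, ?_⟩
  filter_upwards [ae_le_eLpNormEssSup (f := F) (μ := (volume : Measure ℝ))] with x hx
  have h2 : eLpNormEssSup F volume ≠ ∞ := by
    have := hF.2
    rw [eLpNorm_exponent_top] at this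
    exact this.ne
  have := ENNReal.toReal_mono h2 hx
  simpa using this

open scoped Convolution in
theorem correlation_convolution {F W₁ W₂ : ℝ → ℂ} (hF : MemLp F ∞ (volume : Measure ℝ))
    (h₁ : Integrable W₁) (h₂ : Integrable W₂) (η : ℝ) :
    ∫ ξ, (∫ w, F w * W₁ (w - ξ)) * W₂ (ξ - η) =
      ∫ w, F w * ∫ ξ, W₁ (w - ξ) * W₂ (ξ - η) := by
  have hi : Integrable (fun p : ℝ × ℝ => W₂ (p.2 - η) * W₁ (p.1 - p.2)) (volume.prod volume) :=
    Integrable.convolution_integrand (L := ContinuousLinearMap.mul ℂ ℂ) (h₂.comp_sub_right η) h₁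
  obtain ⟨C, hC⟩ := memLp_top_bound hF
  have hi2 : Integrable (fun p : ℝ × ℝ => F p.1 * (W₂ (p.2 - η) * W₁ (p.1 - p.2)))
      (volume.prod volume) := by
    refine hi.bdd_mul (c := C) hF.1.comp_fst ?_
    exact Measure.quasiMeasurePreserving_fst.ae hC
  calc ∫ ξ, (∫ w, F w * W₁ (w - ξ)) * W₂ (ξ - η)
      = ∫ ξ, ∫ w, F w * (W₂ (ξ - η) * W₁ (w - ξ)) := by
        congr 1; ext ξ
        rw [← integral_mul_const]
        congr 1; ext w; ring
    _ = ∫ w, ∫ ξ, F w * (W₂ (ξ - η) * W₁ (w - ξ)) := (integral_integral_swap hi2).symm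
    _ = _ := by
        congr 1; ext w
        rw [← integral_const_mul]
        congr 1; ext ξ; ring

theorem correlation_convolution_comm {F W₁ W₂ : ℝ → ℂ} (hF : MemLp F ∞ (volume : Measure ℝ))
    (h₁ : Integrable W₁) (h₂ : Integrable W₂) (η : ℝ) :
    ∫ ξ, (∫ w, F w * W₁ (w - ξ)) * W₂ (ξ - η) = ∫ ξ, (∫ w, F w * W₂ (w - ξ)) * W₁ (ξ - η) := by
  rw [correlation_convolution hF h₁ h₂, correlation_convolution hF h₂ h₁]
  congr 1; ext w
  congr 1
  rw [← integral_sub_left_eq_self _ _ (w + η)]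
  congr 1; ext ξ
  rw [show w - (w + η - ξ) = ξ - η by ring, show w + η - ξ - η = w - ξ by ring, mul_comm]

theorem fourier_comp_neg (W : ℝ → ℂ) (s : ℝ) : 𝓕 (fun t => W (-t)) (-s) = 𝓕 W s := by
  rw [Real.fourier_real_eq, Real.fourier_real_eq, ← integral_neg_eq_self]
  simp

open scoped Convolution in
theorem fourier_correlation {H W : ℝ → ℂ} (h₁ : Integrable H) (h₂ : Integrable W) (s : ℝ) :
    𝓕 (fun η => ∫ ξ, H ξ * W (ξ - η)) (-s) = 𝓕 H (-s) * 𝓕 W s := by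
  have h := Real.fourier_mul_convolution_eq h₁ (h₂.comp_neg) (-s)
  rw [fourier_comp_neg] at h
  rw [← h]
  refine congrArg (fun G : ℝ → ℂ => 𝓕 G (-s)) (funext fun η => ?_)
  simp only [convolution, ContinuousLinearMap.mul_apply', neg_sub]

/-- Correlating `H₁` with `W₂` and `H₂` with `W₁` gives the same function, and the identity is the
Fourier transform of this equality. It eliminates `F`, whose own Fourier transform is only a
distribution. -/
theorem fourier_correlation_comm {F W₁ W₂ H₁ H₂ : ℝ → ℂ} (hF : MemLp F ∞ (volume : Measure ℝ))
    (hW₁ : Integrable W₁) (hW₂ : Integrable W₂) (hH₁ : Integrable H₁) (hH₂ : Integrable H₂)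
    (e₁ : ∀ ξ, H₁ ξ = ∫ w, F w * W₁ (w - ξ)) (e₂ : ∀ ξ, H₂ ξ = ∫ w, F w * W₂ (w - ξ)) (s : ℝ) :
    𝓕 H₁ (-s) * 𝓕 W₂ s = 𝓕 H₂ (-s) * 𝓕 W₁ s := by
  rw [← fourier_correlation hH₁ hW₂, ← fourier_correlation hH₂ hW₁]
  refine congrArg (fun G : ℝ → ℂ => 𝓕 G (-s)) (funext fun η => ?_)
  simp only [e₁, e₂]
  exact correlation_convolution_comm hF hW₁ hW₂ η

/-! ### Matrix elements of the commutator on modulated cutoffs. -/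

/-- The Fourier multiplier with symbol `F`. -/
noncomputable def fourierMul (F : ℝ → ℝ) (hF : MemLp F ∞ (volume : Measure ℝ)) : L2R →L[ℂ] L2R :=
  (FT2.symm : L2R →L[ℂ] L2R) ∘L mulOp (fun w => (F w : ℂ)) hF.ofReal ∘L (FT2 : L2R →L[ℂ] L2R)

/-- `i[F(𝓕), g] = ∑ ⟨φⱼ, ·⟩ φⱼ`, where `F(𝓕)` is the Fourier multiplier with symbol `F`. -/
def IsCommRep {N : ℕ} (F g : ℝ → ℝ) (hF : MemLp F ∞ (volume : Measure ℝ))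
    (hg : MemLp g ∞ (volume : Measure ℝ)) (φ : Fin N → L2R) : Prop :=
  ∀ u : L2R, Complex.I • (fourierMul F hF (funQ g hg u) - funQ g hg (fourierMul F hF u)) =
    ∑ j, inner ℂ (φ j) u • φ j

theorem inner_mulOp_left (m : ℝ → ℝ) (hm : MemLp (fun x => (m x : ℂ)) ∞ (volume : Measure ℝ)) (u v : L2R) :
    inner ℂ (mulOp (fun x => (m x : ℂ)) hm u) v = inner ℂ u (mulOp (fun x => (m x : ℂ)) hm v) := by
  rw [inner_L2R, inner_L2R]
  apply integral_congr_ae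
  filter_upwards [coeFn_mulOp _ hm u, coeFn_mulOp _ hm v] with x h1 h2
  rw [h1, h2, map_mul, Complex.conj_ofReal]; ring

theorem inner_fourierMul_right (F : ℝ → ℝ) (hF : MemLp F ∞ (volume : Measure ℝ)) (u v : L2R) :
    inner ℂ u (fourierMul F hF v) = ∫ w, conj (FT2 u w) * ((F w : ℂ) * FT2 v w) := by
  have : inner ℂ u (fourierMul F hF v)
      = inner ℂ (FT2 u) (mulOp (fun w => (F w : ℂ)) hF.ofReal (FT2 v)) := by
    rw [← FT2.inner_map_map]
    simp [fourierMul]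
  rw [this, inner_L2R]
  apply integral_congr_ae
  filter_upwards [coeFn_mulOp (fun w => (F w : ℂ)) hF.ofReal (FT2 v)] with x h1
  rw [h1]

theorem integrable_const_mul_of_memLp_top {F W : ℝ → ℂ} (hF : MemLp F ∞ (volume : Measure ℝ))
    (hW : Integrable W) : Integrable (fun x => F x * W x) := by
  obtain ⟨C, hC⟩ := memLp_top_bound hF
  exact hW.bdd_mul (c := C) hF.1 hC

theorem memLp_two_mul_of_memLp_top {F W : ℝ → ℂ} (hF : MemLp F ∞ (volume : Measure ℝ))
    (hW : MemLp W 2) : MemLp (fun x => F x * W x) 2 := by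
  exact hW.mul (p := ∞) (q := 2) hF

theorem fourier_fourierChar_mul (p : ℝ → ℂ) (ξ w : ℝ) :
    𝓕 (fun x => (Real.fourierChar (ξ * x) : ℂ) * p x) w = 𝓕 p (w - ξ) := by
  rw [Real.fourier_real_eq, Real.fourier_real_eq]
  congr 1; ext x
  simp only [Circle.smul_def, smul_eq_mul]
  rw [← mul_assoc, ← Circle.coe_mul, ← AddChar.map_add_eq_mul]
  congr 3; ring

theorem memLp_fourierChar (ξ : ℝ) :
    MemLp (fun x : ℝ => (Real.fourierChar (ξ * x) : ℂ)) ∞ (volume : Measure ℝ) := by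
  refine memLp_top_of_bound (C := 1) ?_ (ae_of_all _ fun x => (Circle.norm_coe _).le)
  exact (by fun_prop : Continuous fun x : ℝ => (Real.fourierChar (ξ * x) : ℂ)).aestronglyMeasurable

/-- The function `i(\overline{p̂} q̂ - \overline{q̂} p̂)`. -/
noncomputable def wronskianFT (p q : ℝ → ℂ) (t : ℝ) : ℂ :=
  Complex.I * (conj (𝓕 p t) * 𝓕 q t - conj (𝓕 q t) * 𝓕 p t)

theorem integrable_wronskianFT {p q : ℝ → ℂ} (hp1 : Integrable p) (hp2 : MemLp p 2)
    (hq1 : Integrable q) (hq2 : MemLp q 2) : Integrable (wronskianFT p q) :=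
  ((integrable_conj_mul (memLp_fourier hp1 hp2) (memLp_fourier hq1 hq2)).sub
    (integrable_conj_mul (memLp_fourier hq1 hq2) (memLp_fourier hp1 hp2))).const_mul _

/-- Both sides are `⟨u, Cu⟩` for `u(x) = e^{2πiξx} p(x)`: the modulation translates Fourier
transforms by `ξ`, and self-adjointness of `g(Q)` moves `g` onto the other factor. -/
theorem IsCommRep.sum_norm_sq_fourier {N : ℕ} {F g : ℝ → ℝ} {hF : MemLp F ∞ (volume : Measure ℝ)}
    {hg : MemLp g ∞ (volume : Measure ℝ)} {φ : Fin N → L2R} (h : IsCommRep F g hF hg φ)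
    {p : ℝ → ℝ} (hp1 : Integrable (fun x => (p x : ℂ))) (hp2 : MemLp (fun x => (p x : ℂ)) 2) (ξ : ℝ) :
    ∑ j, conj (𝓕 (fun x => (p x : ℂ) * φ j x) ξ) * 𝓕 (fun x => (p x : ℂ) * φ j x) ξ =
      ∫ w, (F w : ℂ) * wronskianFT (fun x => (p x : ℂ)) (fun x => (g x : ℂ) * p x) (w - ξ) := by
  have hg' : MemLp (fun x => (g x : ℂ)) ∞ (volume : Measure ℝ) := hg.ofReal
  have hF' : MemLp (fun x => (F x : ℂ)) ∞ (volume : Measure ℝ) := hF.ofReal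
  have hq1 := integrable_const_mul_of_memLp_top hg' hp1
  have hq2 := memLp_two_mul_of_memLp_top hg' hp2
  set q : ℝ → ℂ := fun x => (g x : ℂ) * p x with hq
  have hu1 := integrable_const_mul_of_memLp_top (memLp_fourierChar ξ) hp1
  have hu2 := memLp_two_mul_of_memLp_top (memLp_fourierChar ξ) hp2
  have hv1 := integrable_const_mul_of_memLp_top (memLp_fourierChar ξ) hq1
  have hv2 := memLp_two_mul_of_memLp_top (memLp_fourierChar ξ) hq2
  set u : L2R := hu2.toLp _ with hu
  have hB : funQ g hg u = hv2.toLp _ := by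
    apply Lp.ext
    filter_upwards [coeFn_mulOp _ hg' u, hu2.coeFn_toLp, hv2.coeFn_toLp] with x h1 h2 h3
    rw [h3, funQ, h1, h2, hq]; ring
  have hFu : FT2 u =ᵐ[volume] fun w => 𝓕 (fun x => (p x : ℂ)) (w - ξ) := by
    filter_upwards [FT2_toLp hu1 hu2] with w hw
    rw [hu, hw, fourier_fourierChar_mul]
  have hFv : FT2 (funQ g hg u) =ᵐ[volume] fun w => 𝓕 q (w - ξ) := by
    filter_upwards [FT2_toLp hv1 hv2] with w hw
    rw [hB, hw, fourier_fourierChar_mul]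
  have hinner : ∀ j, inner ℂ u (φ j) = 𝓕 (fun x => (p x : ℂ) * φ j x) ξ := by
    intro j
    rw [inner_L2R, Real.fourier_real_eq]
    apply integral_congr_ae
    filter_upwards [hu2.coeFn_toLp] with x hx
    rw [hx, Circle.smul_def, smul_eq_mul, map_mul, Complex.conj_ofReal, mul_assoc, mul_comm x ξ,
      AddChar.map_neg_eq_inv, Circle.coe_inv_eq_conj]
  have key := congrArg (fun v => inner ℂ u v) (h u)
  simp only [inner_sum, inner_smul_right, inner_sub_right] at key
  have hsa : inner ℂ u (funQ g hg (fourierMul F hF u)) =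
      inner ℂ (funQ g hg u) (fourierMul F hF u) := (inner_mulOp_left g hg' _ _).symm
  rw [hsa, inner_fourierMul_right, inner_fourierMul_right] at key
  have hL : ∑ j, inner ℂ (φ j) u * inner ℂ u (φ j) =
    ∑ j, conj (𝓕 (fun x => (p x : ℂ) * φ j x) ξ) * 𝓕 (fun x => (p x : ℂ) * φ j x) ξ := by
    refine Finset.sum_congr rfl fun j _ => ?_
    rw [← hinner j, inner_conj_symm]
  have hWp := memLp_fourier hp1 hp2
  have hWq := memLp_fourier hq1 hq2
  have hi1 := (integrable_const_mul_of_memLp_top hF'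
    ((integrable_conj_mul hWp hWq).comp_sub_right ξ))
  have hi2 := (integrable_const_mul_of_memLp_top hF'
    ((integrable_conj_mul hWq hWp).comp_sub_right ξ))
  have e1 : ∫ w, conj (FT2 u w) * ((F w : ℂ) * FT2 (funQ g hg u) w) =
      ∫ w, (F w : ℂ) * (conj (𝓕 (fun x => (p x : ℂ)) (w - ξ)) * 𝓕 q (w - ξ)) := by
    apply integral_congr_ae
    filter_upwards [hFu, hFv] with w h1 h2
    rw [h1, h2]; ring
  have e2 : ∫ w, conj (FT2 (funQ g hg u) w) * ((F w : ℂ) * FT2 u w) =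
      ∫ w, (F w : ℂ) * (conj (𝓕 q (w - ξ)) * 𝓕 (fun x => (p x : ℂ)) (w - ξ)) := by
    apply integral_congr_ae
    filter_upwards [hFu, hFv] with w h1 h2
    rw [h1, h2]; ring
  rw [← hL, ← key, e1, e2, ← integral_sub hi1 hi2, ← integral_const_mul]
  congr 1; ext w
  simp only [wronskianFT]; ring

/-- The kernel `∑ φⱼ(x) \overline{φⱼ(y)}`. -/
noncomputable def sumKernel {N : ℕ} (φ : Fin N → ℝ → ℂ) (x y : ℝ) : ℂ := ∑ j, φ j x * conj (φ j y)

/-- The density `∑ |φⱼ(x)|²`. -/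
noncomputable def density {N : ℕ} (φ : Fin N → ℝ → ℂ) (x : ℝ) : ℝ := ∑ j, ‖φ j x‖ ^ 2

theorem sumKernel_self {N : ℕ} (φ : Fin N → ℝ → ℂ) (x : ℝ) : sumKernel φ x x = density φ x := by
  simp [sumKernel, density, Complex.mul_conj']

theorem density_nonneg {N : ℕ} (φ : Fin N → ℝ → ℂ) (x : ℝ) : 0 ≤ density φ x :=
  Finset.sum_nonneg fun _ _ => by positivity

theorem integrable_norm_sq {m : ℝ → ℂ} (hm : MemLp m 2) : Integrable (fun x => ‖m x‖ ^ 2) :=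
  hm.integrable_norm_pow (by norm_num)

theorem integrable_density {N : ℕ} (φ : Fin N → L2R) : Integrable (density fun j => φ j) :=
  integrable_finsetSum _ fun j _ => integrable_norm_sq (Lp.memLp (φ j))

theorem integrable_fourier_integrand {f : ℝ → ℂ} (hf : Integrable f) (w : ℝ) :
    Integrable (fun v => Real.fourierChar (-(v * w)) • f v) := by
  simpa [mul_comm] using (Real.fourierIntegral_convergent_iff w).2 hf

/-- `∑ⱼ |𝓕 (p φⱼ)|²`. -/
noncomputable def cutoffDensityFT {N : ℕ} (φ : Fin N → L2R) (p : ℝ → ℝ) (ξ : ℝ) : ℂ :=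
  ∑ j, conj (𝓕 (fun x => (p x : ℂ) * φ j x) ξ) * 𝓕 (fun x => (p x : ℂ) * φ j x) ξ

section cutoff

variable {N : ℕ} {φ : Fin N → L2R} {p : ℝ → ℝ}

theorem integrable_cutoff (hp2 : MemLp (fun x => (p x : ℂ)) 2) (j : Fin N) :
    Integrable (fun x => (p x : ℂ) * φ j x) :=
  hp2.integrable_mul (Lp.memLp (φ j))

theorem memLp_two_cutoff (hp : MemLp (fun x => (p x : ℂ)) ∞) (j : Fin N) :
    MemLp (fun x => (p x : ℂ) * φ j x) 2 :=
  memLp_two_mul_of_memLp_top hp (Lp.memLp (φ j))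

theorem integrable_cutoffDensityFT (hp2 : MemLp (fun x => (p x : ℂ)) 2)
    (hp : MemLp (fun x => (p x : ℂ)) ∞) : Integrable (cutoffDensityFT φ p) :=
  integrable_finsetSum _ fun j _ =>
    integrable_conj_mul (memLp_fourier (integrable_cutoff hp2 j) (memLp_two_cutoff hp j))
      (memLp_fourier (integrable_cutoff hp2 j) (memLp_two_cutoff hp j))

theorem fourier_finset_sum {ι : Type*} (s : Finset ι) {f : ι → ℝ → ℂ} (hf : ∀ i ∈ s, Integrable (f i))
    (w : ℝ) : 𝓕 (fun x => ∑ i ∈ s, f i x) w = ∑ i ∈ s, 𝓕 (f i) w := by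
  simp only [Real.fourier_real_eq, Finset.smul_sum]
  rw [integral_finsetSum]
  intro i hi
  exact integrable_fourier_integrand (hf i hi) w

/-- Parseval: at frequency `-s` only the kernel at distance `s` from the diagonal is seen. -/
theorem fourier_cutoffDensityFT (hp2 : MemLp (fun x => (p x : ℂ)) 2)
    (hp : MemLp (fun x => (p x : ℂ)) ∞) (s : ℝ) :
    𝓕 (cutoffDensityFT φ p) (-s) =
      ∫ x, (p x * p (x + s) : ℝ) * sumKernel (fun j => φ j) (x + s) x := by
  have h1 := fun j => integrable_cutoff (φ := φ) hp2 j
  have h2 := fun j => memLp_two_cutoff (φ := φ) hp j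
  have hf := fun j => memLp_fourier (h1 j) (h2 j)
  unfold cutoffDensityFT
  rw [fourier_finset_sum _ fun j _ => integrable_conj_mul (hf j) (hf j)]
  have : ∀ j, 𝓕 (fun ξ => conj (𝓕 (fun x => (p x : ℂ) * φ j x) ξ) *
      𝓕 (fun x => (p x : ℂ) * φ j x) ξ) (-s) =
      ∫ x, conj ((p x : ℂ) * φ j x) * ((p (x + s) : ℂ) * φ j (x + s)) := by
    intro j
    rw [fourier_conj_fourier_mul_fourier (h1 j) (h2 j) (h1 j) (h2 j)]
    simp only [sub_neg_eq_add]
  simp_rw [this]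
  rw [← integral_finsetSum]
  · congr 1; ext x
    simp only [sumKernel, Finset.mul_sum]
    refine Finset.sum_congr rfl fun j _ => ?_
    simp only [map_mul, Complex.conj_ofReal]
    push_cast; ring
  · intro j _
    have hs := measurePreserving_add_right (volume : Measure ℝ) s
    exact integrable_conj_mul (h2 j) ((h2 j).comp_measurePreserving hs)

end cutoff

theorem fourier_wronskianFT {g : ℝ → ℝ} (hg : MemLp g ∞ (volume : Measure ℝ)) {p : ℝ → ℝ}
    (hp1 : Integrable (fun x => (p x : ℂ))) (hp2 : MemLp (fun x => (p x : ℂ)) 2) (s : ℝ) :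
    𝓕 (wronskianFT (fun x => (p x : ℂ)) (fun x => (g x : ℂ) * p x)) s =
      -Complex.I * ∫ x, (p x * p (x + s) * (g (x + s) - g x) : ℝ) := by
  have hg' : MemLp (fun x => (g x : ℂ)) ∞ (volume : Measure ℝ) := hg.ofReal
  have hq1 := integrable_const_mul_of_memLp_top hg' hp1
  have hq2 := memLp_two_mul_of_memLp_top hg' hp2
  set q : ℝ → ℂ := fun x => (g x : ℂ) * p x with hq
  have hWp := memLp_fourier hp1 hp2
  have hWq := memLp_fourier hq1 hq2
  have hs := measurePreserving_sub_right (volume : Measure ℝ) s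
  have e1 := fourier_conj_fourier_mul_fourier hp1 hp2 hq1 hq2 s
  have e2 := fourier_conj_fourier_mul_fourier hq1 hq2 hp1 hp2 s
  have i1 := integrable_conj_mul hWp hWq
  have i2 := integrable_conj_mul hWq hWp
  have : 𝓕 (wronskianFT (fun x => (p x : ℂ)) q) s = Complex.I *
      (𝓕 (fun t => conj (𝓕 (fun x => (p x : ℂ)) t) * 𝓕 q t) s -
        𝓕 (fun t => conj (𝓕 q t) * 𝓕 (fun x => (p x : ℂ)) t) s) := by
    rw [Real.fourier_real_eq, Real.fourier_real_eq, Real.fourier_real_eq,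
      ← integral_sub (integrable_fourier_integrand i1 s) (integrable_fourier_integrand i2 s),
      ← integral_const_mul]
    congr 1; ext t
    simp only [wronskianFT, Circle.smul_def, smul_eq_mul]; ring
  have j1 : Integrable (fun x => conj (p x : ℂ) * q (x - s)) :=
    integrable_conj_mul hp2 (hq2.comp_measurePreserving hs)
  have j2 : Integrable (fun x => conj (q x) * (p (x - s) : ℂ)) :=
    integrable_conj_mul hq2 (hp2.comp_measurePreserving hs)
  rw [this, e1, e2, ← integral_sub j1 j2, neg_mul, ← mul_neg, ← integral_complex_ofReal,
    ← integral_neg]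
  refine congrArg (Complex.I * ·) ?_
  rw [← integral_add_right_eq_self _ s]
  congr 1; ext x
  simp only [hq, map_mul, Complex.conj_ofReal, add_sub_cancel_right]
  push_cast; ring

/-- This is an integrated form of the statement that `K(x+s,x) / (g(x+s) - g(x))` depends on `s`
only. -/
theorem IsCommRep.cutoff_comm {N : ℕ} {F g : ℝ → ℝ} {hF : MemLp F ∞ (volume : Measure ℝ)}
    {hg : MemLp g ∞ (volume : Measure ℝ)} {φ : Fin N → L2R} (h : IsCommRep F g hF hg φ)
    {p q : ℝ → ℝ} (hp1 : Integrable (fun x => (p x : ℂ))) (hp2 : MemLp (fun x => (p x : ℂ)) 2)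
    (hp : MemLp (fun x => (p x : ℂ)) ∞)
    (hq1 : Integrable (fun x => (q x : ℂ))) (hq2 : MemLp (fun x => (q x : ℂ)) 2)
    (hq : MemLp (fun x => (q x : ℂ)) ∞) (s : ℝ) :
    𝓕 (cutoffDensityFT φ p) (-s) * (∫ x, q x * q (x + s) * (g (x + s) - g x) : ℝ) =
      𝓕 (cutoffDensityFT φ q) (-s) * (∫ x, p x * p (x + s) * (g (x + s) - g x) : ℝ) := by
  have hg' : MemLp (fun x => (g x : ℂ)) ∞ (volume : Measure ℝ) := hg.ofReal
  have key := fourier_correlation_comm (hF.ofReal : MemLp (fun x => (F x : ℂ)) ∞ volume)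
    (integrable_wronskianFT hp1 hp2 (integrable_const_mul_of_memLp_top hg' hp1)
      (memLp_two_mul_of_memLp_top hg' hp2))
    (integrable_wronskianFT hq1 hq2 (integrable_const_mul_of_memLp_top hg' hq1)
      (memLp_two_mul_of_memLp_top hg' hq2))
    (integrable_cutoffDensityFT (φ := φ) hp2 hp) (integrable_cutoffDensityFT (φ := φ) hq2 hq)
    (fun ξ => h.sum_norm_sq_fourier hp1 hp2 ξ) (fun ξ => h.sum_norm_sq_fourier hq1 hq2 ξ) s
  rw [fourier_wronskianFT hg hp1 hp2, fourier_wronskianFT hg hq1 hq2] at key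
  have hI : -Complex.I ≠ 0 := by simp
  refine mul_left_cancel₀ hI ?_
  linear_combination key

/-! ### Interval cutoffs: `g` as a primitive of the density. -/

/-- The indicator function of `[a, b]`. -/
noncomputable def iccInd (a b : ℝ) : ℝ → ℝ := Set.indicator (Set.Icc a b) 1

theorem ofReal_iccInd (a b : ℝ) :
    (fun x => (iccInd a b x : ℂ)) = Set.indicator (Set.Icc a b) (fun _ => (1 : ℂ)) := by
  ext x; by_cases hx : x ∈ Set.Icc a b <;> simp [iccInd, hx]

theorem memLp_iccInd (a b : ℝ) (p : ℝ≥0∞) : MemLp (fun x => (iccInd a b x : ℂ)) p := by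
  rw [ofReal_iccInd]
  exact memLp_indicator_const p measurableSet_Icc 1 (Or.inr (by simp))

theorem integrable_iccInd (a b : ℝ) : Integrable (fun x => (iccInd a b x : ℂ)) :=
  memLp_one_iff_integrable.1 (memLp_iccInd a b 1)

theorem iccInd_mul_iccInd_add {a b s : ℝ} (hs : 0 ≤ s) (x : ℝ) :
    iccInd a b x * iccInd a b (x + s) = iccInd a (b - s) x := by
  simp only [iccInd, Set.indicator, Set.mem_Icc, Pi.one_apply]
  split_ifs with h1 h2 h3 h3 h3 h3 <;> first | simp; done | (exfalso; simp only [not_and, not_le] at *; grind)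

theorem integral_iccInd_mul {E : Type*} [NormedAddCommGroup E] [NormedSpace ℝ E] (a b : ℝ) (f : ℝ → E) :
    ∫ x, iccInd a b x • f x = ∫ x in Set.Icc a b, f x := by
  rw [← integral_indicator measurableSet_Icc]
  congr 1; ext x
  by_cases hx : x ∈ Set.Icc a b <;> simp [iccInd, hx]

theorem intervalIntegrable_of_memLp_top {g : ℝ → ℝ} (hg : MemLp g ∞ (volume : Measure ℝ)) (a b : ℝ) :
    IntervalIntegrable g volume a b :=
  ((hg.locallyIntegrable le_top).integrableOn_isCompact isCompact_uIcc).intervalIntegrable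

theorem integral_iccInd_diff {g : ℝ → ℝ} (hg : MemLp g ∞ (volume : Measure ℝ)) {a b s : ℝ}
    (hs : 0 ≤ s) (hab : s ≤ b - a) :
    ∫ x, iccInd a b x * iccInd a b (x + s) * (g (x + s) - g x) =
      (∫ x in (b - s)..b, g x) - ∫ x in a..(a + s), g x := by
  have hi := fun a b => intervalIntegrable_of_memLp_top hg a b
  simp_rw [iccInd_mul_iccInd_add hs]
  have h1 := integral_iccInd_mul a (b - s) (fun x => g (x + s) - g x)
  simp only [smul_eq_mul] at h1
  rw [h1, integral_Icc_eq_integral_Ioc, ← intervalIntegral.integral_of_le (by linarith),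
    intervalIntegral.integral_sub _ (hi _ _), intervalIntegral.integral_comp_add_right]
  · rw [sub_add_cancel]
    have e1 := intervalIntegral.integral_add_adjacent_intervals (hi a (a + s)) (hi (a + s) b)
    have e2 := intervalIntegral.integral_add_adjacent_intervals (hi a (b - s)) (hi (b - s) b)
    linarith
  · have := (hi (a + s) (b - s + s)).comp_add_right s
    simpa using this

theorem fourier_cutoffDensityFT_iccInd {N : ℕ} (φ : Fin N → L2R) (a b : ℝ) {s : ℝ} (hs : 0 ≤ s) :
    𝓕 (cutoffDensityFT φ (iccInd a b)) (-s) =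
      ∫ x in Set.Icc a (b - s), sumKernel (fun j => φ j) (x + s) x := by
  rw [fourier_cutoffDensityFT (memLp_iccInd a b 2) (memLp_iccInd a b ∞), ← integral_iccInd_mul]
  congr 1; ext x
  rw [iccInd_mul_iccInd_add hs]
  simp

theorem tendsto_fourier_cutoffDensityFT_iccInd {N : ℕ} (φ : Fin N → L2R) (a b : ℝ) :
    Tendsto (fun s => 𝓕 (cutoffDensityFT φ (iccInd a b)) (-s)) (𝓝[>] 0)
      (𝓝 ((∫ x in Set.Icc a b, density (fun j => φ j) x : ℝ) : ℂ)) := by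
  have hc := continuous_fourier (integrable_cutoffDensityFT (φ := φ) (memLp_iccInd a b 2)
    (memLp_iccInd a b ∞))
  have h0 := fourier_cutoffDensityFT_iccInd φ a b le_rfl
  simp only [add_zero, sub_zero, sumKernel_self] at h0
  rw [integral_complex_ofReal] at h0
  have : Tendsto (fun s => 𝓕 (cutoffDensityFT φ (iccInd a b)) (-s)) (𝓝 0)
      (𝓝 (𝓕 (cutoffDensityFT φ (iccInd a b)) (-0))) := (hc.comp continuous_neg).tendsto 0
  rw [h0] at this
  exact this.mono_left nhdsWithin_le_nhds

/-- The difference integral telescopes to two integrals of length `s` at the ends of the interval,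
so only Lebesgue differentiation of `g` at `a` and `b` is needed. -/
theorem tendsto_integral_iccInd_diff {g : ℝ → ℝ} (hg : MemLp g ∞ (volume : Measure ℝ)) {a b : ℝ}
    (hab : a < b) (ha : ∀ c, HasDerivAt (fun x => ∫ t in c..x, g t) (g a) a)
    (hb : ∀ c, HasDerivAt (fun x => ∫ t in c..x, g t) (g b) b) :
    Tendsto (fun s => s⁻¹ * ∫ x, iccInd a b x * iccInd a b (x + s) * (g (x + s) - g x)) (𝓝[>] 0)
      (𝓝 (g b - g a)) := by
  have h1 : Tendsto (fun s => s⁻¹ • ((∫ t in a..(a + s), g t) - ∫ t in a..a, g t)) (𝓝[>] 0) (𝓝 (g a)) :=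
    (ha a).tendsto_slope_zero_right
  have h2 := (hb b).tendsto_slope_zero_left
  have h3 : Tendsto (fun s : ℝ => -s) (𝓝[>] 0) (𝓝[<] 0) := by
    simpa using tendsto_neg_nhdsGT (a := (0 : ℝ))
  have h4 := h2.comp h3
  refine (h4.sub h1).congr' ?_
  filter_upwards [Ioo_mem_nhdsGT (sub_pos.2 hab)] with s hs
  rw [integral_iccInd_diff hg hs.1.le hs.2.le]
  simp only [Function.comp, intervalIntegral.integral_same, sub_zero, smul_eq_mul, ← sub_eq_add_neg]
  rw [intervalIntegral.integral_symm, inv_neg]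
  ring

/-- The limit `s → 0+` of `IsCommRep.cutoff_comm`, divided by `s`, for two interval cutoffs. -/
theorem IsCommRep.lebesgue_identity {N : ℕ} {F g : ℝ → ℝ} {hF : MemLp F ∞ (volume : Measure ℝ)}
    {hg : MemLp g ∞ (volume : Measure ℝ)} {φ : Fin N → L2R} (h : IsCommRep F g hF hg φ)
    {a b a' b' : ℝ} (hab : a < b) (hab' : a' < b')
    (ha : ∀ c, HasDerivAt (fun x => ∫ t in c..x, g t) (g a) a)
    (hb : ∀ c, HasDerivAt (fun x => ∫ t in c..x, g t) (g b) b)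
    (ha' : ∀ c, HasDerivAt (fun x => ∫ t in c..x, g t) (g a') a')
    (hb' : ∀ c, HasDerivAt (fun x => ∫ t in c..x, g t) (g b') b') :
    (∫ x in a..b, density (fun j => φ j) x) * (g b' - g a') =
      (∫ x in a'..b', density (fun j => φ j) x) * (g b - g a) := by
  have t1 := (tendsto_fourier_cutoffDensityFT_iccInd φ a b).mul
    ((Complex.continuous_ofReal.tendsto _).comp (tendsto_integral_iccInd_diff hg hab' ha' hb'))
  have t2 := (tendsto_fourier_cutoffDensityFT_iccInd φ a' b').mul
    ((Complex.continuous_ofReal.tendsto _).comp (tendsto_integral_iccInd_diff hg hab ha hb))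
  have := tendsto_nhds_unique t1 (t2.congr fun s => ?_)
  · rw [intervalIntegral.integral_of_le hab.le, intervalIntegral.integral_of_le hab'.le,
      ← integral_Icc_eq_integral_Ioc, ← integral_Icc_eq_integral_Ioc]
    exact_mod_cast this
  · have key := h.cutoff_comm (integrable_iccInd a b) (memLp_iccInd a b 2) (memLp_iccInd a b ∞)
      (integrable_iccInd a' b') (memLp_iccInd a' b' 2) (memLp_iccInd a' b' ∞) s
    simp only [Function.comp, Complex.ofReal_mul]
    linear_combination -(s⁻¹ : ℝ) * key

theorem IsCommRep.congr {N : ℕ} {F g F' g' : ℝ → ℝ} {hF : MemLp F ∞ (volume : Measure ℝ)}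
    {hg : MemLp g ∞ (volume : Measure ℝ)} {φ : Fin N → L2R} (h : IsCommRep F g hF hg φ)
    (hF' : MemLp F' ∞ (volume : Measure ℝ)) (hg' : MemLp g' ∞ (volume : Measure ℝ))
    (eF : F' =ᵐ[volume] F) (eg : g' =ᵐ[volume] g) : IsCommRep F' g' hF' hg' φ := by
  have h1 : funQ g' hg' = funQ g hg := by
    ext1 u
    apply Lp.ext
    filter_upwards [coeFn_mulOp (fun x => (g x : ℂ)) hg.ofReal u,
      coeFn_mulOp (fun x => (g' x : ℂ)) hg'.ofReal u, eg] with x a b c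
    rw [funQ, funQ, a, b, c]
  have h2 : mulOp (fun x => (F' x : ℂ)) hF'.ofReal = mulOp (fun x => (F x : ℂ)) hF.ofReal := by
    ext1 u
    apply Lp.ext
    filter_upwards [coeFn_mulOp (fun x => (F x : ℂ)) hF.ofReal u,
      coeFn_mulOp (fun x => (F' x : ℂ)) hF'.ofReal u, eF] with x a b c
    rw [a, b, c]
  intro u
  have := h u
  rw [fourierMul] at this ⊢
  rw [h1, h2]; exact this

/-- The commutator vanishes, so its quadratic form at `φ j` gives `∑ᵢ |⟨φᵢ, φⱼ⟩|² = 0`, and the term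
`i = j` suffices. -/
theorem IsCommRep.eq_zero_of_const {N : ℕ} {F g : ℝ → ℝ} {hF : MemLp F ∞ (volume : Measure ℝ)}
    {hg : MemLp g ∞ (volume : Measure ℝ)} {φ : Fin N → L2R} (h : IsCommRep F g hF hg φ)
    {c : ℝ} (hc : ∀ᵐ x, g x = c) (j : Fin N) : φ j = 0 := by
  have h1 : ∀ u, funQ g hg u = (c : ℂ) • u := by
    intro u
    apply Lp.ext
    filter_upwards [coeFn_mulOp (fun x => (g x : ℂ)) hg.ofReal u, Lp.coeFn_smul (c : ℂ) u, hc]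
      with x a b d
    rw [funQ, a, b, d]; rfl
  have h2 := h (φ j)
  rw [h1, h1, map_smul, sub_self, smul_zero] at h2
  have h3 := congrArg (fun v => RCLike.re (inner ℂ (φ j) v)) h2
  simp only [inner_zero_right, inner_sum, inner_smul_right] at h3
  have h4 : ∀ i, inner ℂ (φ i) (φ j) * inner ℂ (φ j) (φ i) = ((‖inner ℂ (φ i) (φ j)‖ ^ 2 : ℝ) : ℂ) := by
    intro i
    rw [← inner_conj_symm (φ j) (φ i), Complex.mul_conj']
    norm_cast
  simp_rw [h4] at h3
  rw [← Complex.ofReal_sum, map_zero] at h3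
  have h5 : ∑ i, ‖inner ℂ (φ i) (φ j)‖ ^ 2 = 0 := h3.symm
  have h6 := (Finset.sum_eq_zero_iff_of_nonneg (fun i _ => by positivity)).1 h5 j (Finset.mem_univ j)
  simpa using h6

theorem density_ae_eq_zero {N : ℕ} {φ : Fin N → L2R}
    (h : density (fun j => φ j) =ᵐ[volume] 0) (j : Fin N) : φ j = 0 := by
  rw [Lp.eq_zero_iff_ae_eq_zero]
  filter_upwards [h] with x hx
  have := (Finset.sum_eq_zero_iff_of_nonneg (fun i _ => by positivity)).1 hx j (Finset.mem_univ j)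
  simpa using this

theorem integral_density_pos {N : ℕ} {φ : Fin N → L2R} {j : Fin N} (hj : φ j ≠ 0) :
    0 < ∫ x, density (fun j => φ j) x := by
  refine lt_of_le_of_ne (integral_nonneg fun x => density_nonneg _ x) fun h => hj ?_
  refine density_ae_eq_zero ?_ j
  exact (integral_eq_zero_iff_of_nonneg (fun x => density_nonneg _ x) (integrable_density φ)).1 h.symm

/-- By `IsCommRep.lebesgue_identity` the increments of `g` between Lebesgue points are proportional
to the integrals of the density. The work is to find one interval where both are non-zero. -/
theorem IsCommRep.exists_primitive {N : ℕ} {F g : ℝ → ℝ} {hF : MemLp F ∞ (volume : Measure ℝ)}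
    {hg : MemLp g ∞ (volume : Measure ℝ)} {φ : Fin N → L2R} (h : IsCommRep F g hF hg φ)
    {j : Fin N} (hj : φ j ≠ 0) :
    ∃ G c : ℝ, c ≠ 0 ∧ ∀ᵐ x, g x = G + c * ∫ t in Set.Iic x, density (fun j => φ j) t := by
  set κ := density (fun j => φ j) with hκ
  have hκi : Integrable κ := integrable_density φ
  set E : Set ℝ := {x | ∀ c, HasDerivAt (fun x => ∫ t in c..x, g t) (g x) x} with hE
  have hEae : ∀ᵐ x, x ∈ E := LocallyIntegrable.ae_hasDerivAt_integral (hg.locallyIntegrable le_top)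
  have hEd : Dense E := Measure.dense_of_ae hEae
  have hid : ∀ a ∈ E, ∀ b ∈ E, ∀ a' ∈ E, ∀ b' ∈ E, a < b → a' < b' →
      (∫ x in a..b, κ x) * (g b' - g a') = (∫ x in a'..b', κ x) * (g b - g a) :=
    fun a ha b hb a' ha' b' hb' hab hab' => h.lebesgue_identity hab hab' ha hb ha' hb'
  obtain ⟨a', ha', b', hb', hab', hne⟩ : ∃ a' ∈ E, ∃ b' ∈ E, a' < b' ∧ g a' ≠ g b' := by
    by_contra! hcon
    obtain ⟨a, ha⟩ := hEd.nonempty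
    refine hj (h.eq_zero_of_const (c := g a) ?_ j)
    filter_upwards [hEae] with x hx
    rcases lt_trichotomy a x with hlt | rfl | hlt
    · exact (hcon a ha x hx hlt).symm
    · rfl
    · exact hcon x hx a ha hlt
  -- Otherwise the identity makes the integral of `κ` vanish on every interval with ends in `E`, and
  -- then on the whole line.
  have hκne : ∫ x in a'..b', κ x ≠ 0 := by
    intro h0
    have hz : ∀ n : ℕ, ∫ x in (-(n : ℝ))..n, κ x = 0 := by
      intro n
      obtain ⟨a, ha, han⟩ := hEd.exists_lt (-(n : ℝ))
      obtain ⟨b, hb, hbn⟩ := hEd.exists_gt (n : ℝ)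
      have hn : (0 : ℝ) ≤ n := n.cast_nonneg
      have h1 := hid a ha b hb a' ha' b' hb' (by linarith) hab'
      rw [h0, zero_mul] at h1
      have h2 : ∫ x in a..b, κ x = 0 := by
        rcases mul_eq_zero.1 h1 with h1 | h1
        · exact h1
        · exact absurd (sub_eq_zero.1 h1).symm hne
      refine le_antisymm ?_ (intervalIntegral.integral_nonneg (by linarith) fun x _ => density_nonneg _ x)
      rw [← h2]
      exact intervalIntegral.integral_mono_interval han.le (by linarith) hbn.le
        (ae_of_all _ fun x => density_nonneg _ x) hκi.intervalIntegrable
    have ht : Tendsto (fun n : ℕ => ∫ x in (-(n : ℝ))..n, κ x) atTop (𝓝 (∫ x, κ x)) :=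
      intervalIntegral_tendsto_integral hκi
        (tendsto_neg_atTop_atBot.comp tendsto_natCast_atTop_atTop) tendsto_natCast_atTop_atTop
    simp_rw [hz] at ht
    exact (integral_density_pos hj).ne (tendsto_nhds_unique tendsto_const_nhds ht)
  set c := (g b' - g a') / ∫ x in a'..b', κ x with hc
  have hlt : ∀ a ∈ E, ∀ b ∈ E, a < b → g b - g a = c * ∫ x in a..b, κ x := by
    intro a ha b hb hab
    have := hid a ha b hb a' ha' b' hb' hab hab'
    rw [hc]; field_simp; linarith
  refine ⟨g a' - c * ∫ t in Set.Iic a', κ t, c, div_ne_zero (sub_ne_zero.2 hne.symm) hκne, ?_⟩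
  filter_upwards [hEae] with x hx
  have e := intervalIntegral.integral_Iic_sub_Iic (a := a') (b := x) hκi.integrableOn hκi.integrableOn
  have : g x - g a' = c * ∫ t in a'..x, κ t := by
    rcases lt_trichotomy a' x with hl | rfl | hl
    · exact hlt _ ha' _ hx hl
    · simp
    · rw [intervalIntegral.integral_symm]
      linarith [hlt _ hx _ ha' hl]
  rw [← e] at this
  linarith

/-! ### The correlation function and the factorization of the kernel. -/

/-- `𝓕⁻¹ (∑ |φ̂ⱼ|²)`. -/
noncomputable def corrFun {N : ℕ} (φ : Fin N → L2R) (s : ℝ) : ℂ :=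
  𝓕 (fun ξ => (density (fun j => FT2 (φ j)) ξ : ℂ)) (-s)

theorem continuous_corrFun {N : ℕ} (φ : Fin N → L2R) : Continuous (corrFun φ) :=
  (continuous_fourier (integrable_density fun j => FT2 (φ j)).ofReal).comp continuous_neg

theorem inner_fourierChar_mul (a : L2R) (s : ℝ) :
    inner ℂ a (mulOp _ (memLp_fourierChar s) a) = 𝓕 (fun x => conj (a x) * a x) (-s) := by
  rw [inner_L2R, Real.fourier_real_eq]
  apply integral_congr_ae
  filter_upwards [coeFn_mulOp _ (memLp_fourierChar s) a] with x hx
  rw [hx, Circle.smul_def, smul_eq_mul, show -(x * -s) = s * x by ring]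
  ring

theorem corrFun_eq_inner {N : ℕ} (φ : Fin N → L2R) (s : ℝ) :
    corrFun φ s = ∑ j, inner ℂ (FT2 (φ j)) (mulOp _ (memLp_fourierChar s) (FT2 (φ j))) := by
  simp_rw [inner_fourierChar_mul]
  rw [← fourier_finset_sum _ fun j _ =>
    integrable_conj_mul (Lp.memLp (FT2 (φ j))) (Lp.memLp (FT2 (φ j)))]
  simp [corrFun, density, Complex.conj_mul']

/-- In this form the left side is continuous in `p φⱼ ∈ L²`, which allows the cutoff to be removed
by `tendsto_mulOp_iccInd`. -/
theorem fourier_cutoffDensityFT_eq_inner {N : ℕ} (φ : Fin N → L2R) {p : ℝ → ℝ}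
    (hp2 : MemLp (fun x => (p x : ℂ)) 2) (hp : MemLp (fun x => (p x : ℂ)) ∞) (s : ℝ) :
    𝓕 (cutoffDensityFT φ p) (-s) = ∑ j, inner ℂ (FT2 (mulOp _ hp (φ j)))
      (mulOp _ (memLp_fourierChar s) (FT2 (mulOp _ hp (φ j)))) := by
  simp_rw [inner_fourierChar_mul]
  rw [← fourier_finset_sum _ fun j _ =>
    integrable_conj_mul (Lp.memLp (FT2 (mulOp _ hp (φ j)))) (Lp.memLp (FT2 (mulOp _ hp (φ j))))]
  apply Real.fourier_congr_ae
  have : ∀ j, FT2 (mulOp _ hp (φ j)) =ᵐ[volume] 𝓕 (fun x => (p x : ℂ) * φ j x) := by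
    intro j
    have e : mulOp _ hp (φ j) = (memLp_two_cutoff hp j).toLp (fun x => (p x : ℂ) * φ j x) := by
      apply Lp.ext
      filter_upwards [coeFn_mulOp _ hp (φ j), (memLp_two_cutoff (φ := φ) hp j).coeFn_toLp] with x h1 h2
      rw [h1, h2]
    rw [e]
    exact FT2_toLp (integrable_cutoff hp2 j) (memLp_two_cutoff hp j)
  filter_upwards [ae_all_iff.2 this] with x hx
  simp only [cutoffDensityFT, hx]

theorem norm_sq_L2R (u : L2R) : ‖u‖ ^ 2 = ∫ x, ‖u x‖ ^ 2 := by
  have h := inner_self_eq_norm_sq_to_K (𝕜 := ℂ) u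
  rw [inner_L2R] at h
  simp_rw [Complex.conj_mul'] at h
  have h2 : ((∫ x, ‖u x‖ ^ 2 : ℝ) : ℂ) = ((‖u‖ ^ 2 : ℝ) : ℂ) := by
    rw [← integral_complex_ofReal]
    push_cast
    exact h
  exact_mod_cast h2.symm

theorem tendsto_mulOp_iccInd (u : L2R) :
    Tendsto (fun n : ℕ => mulOp _ (memLp_iccInd (-(n : ℝ)) n ∞) u) atTop (𝓝 u) := by
  rw [tendsto_iff_norm_sub_tendsto_zero]
  have h2 : Tendsto (fun n : ℕ => ‖mulOp _ (memLp_iccInd (-(n : ℝ)) n ∞) u - u‖ ^ 2) atTop (𝓝 0) := by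
    have h3 : ∀ n : ℕ, ‖mulOp _ (memLp_iccInd (-(n : ℝ)) n ∞) u - u‖ ^ 2
        = ∫ x, (1 - iccInd (-(n : ℝ)) n x) * ‖u x‖ ^ 2 := by
      intro n
      rw [norm_sq_L2R]
      apply integral_congr_ae
      filter_upwards [coeFn_mulOp _ (memLp_iccInd (-(n : ℝ)) n ∞) u,
        Lp.coeFn_sub (mulOp _ (memLp_iccInd (-(n : ℝ)) n ∞) u) u] with x a b
      rw [b, Pi.sub_apply, a]
      by_cases hx : x ∈ Set.Icc (-(n : ℝ)) n <;> simp [iccInd, hx]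
    simp_rw [h3]
    have h4 : (0 : ℝ) = ∫ x : ℝ, (0 : ℝ) := by simp
    rw [h4]
    refine tendsto_integral_of_dominated_convergence (fun x => ‖u x‖ ^ 2) ?_
      (integrable_norm_sq (Lp.memLp u)) ?_ ?_
    · intro n
      refine AEStronglyMeasurable.mul ?_ (integrable_norm_sq (Lp.memLp u)).1
      exact (measurable_const.sub (measurable_one.indicator measurableSet_Icc)).aestronglyMeasurable
    · intro n
      refine ae_of_all _ fun x => ?_
      by_cases hx : x ∈ Set.Icc (-(n : ℝ)) n <;> simp [iccInd, hx]
    · refine ae_of_all _ fun x => ?_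
      refine tendsto_const_nhds.congr' ?_
      obtain ⟨m, hm⟩ := exists_nat_ge |x|
      filter_upwards [eventually_ge_atTop m] with n hn
      have : x ∈ Set.Icc (-(n : ℝ)) n := by
        rw [Set.mem_Icc, ← abs_le]
        exact hm.trans (by exact_mod_cast hn)
      simp [iccInd, this]
  have := h2.sqrt
  simpa using this

theorem tendsto_fourier_cutoffDensityFT_corrFun {N : ℕ} (φ : Fin N → L2R) (s : ℝ) :
    Tendsto (fun n : ℕ => 𝓕 (cutoffDensityFT φ (iccInd (-(n : ℝ)) n)) (-s)) atTop
      (𝓝 (corrFun φ s)) := by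
  rw [corrFun_eq_inner]
  simp_rw [fun n : ℕ => fourier_cutoffDensityFT_eq_inner φ (memLp_iccInd (-(n : ℝ)) n 2)
    (memLp_iccInd (-(n : ℝ)) n ∞) s]
  refine tendsto_finsetSum _ fun j _ => ?_
  have hc : Continuous fun a : L2R => inner ℂ (FT2 a) (mulOp _ (memLp_fourierChar s) (FT2 a)) := by
    have : Continuous FT2 := FT2.continuous
    fun_prop
  exact (hc.tendsto (φ j)).comp (tendsto_mulOp_iccInd (φ j))

theorem integrable_sumKernel_shift {N : ℕ} (φ : Fin N → L2R) (s : ℝ) :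
    Integrable (fun x => sumKernel (fun j => φ j) (x + s) x) := by
  refine integrable_finsetSum _ fun j _ => ?_
  have hs := measurePreserving_add_right (volume : Measure ℝ) s
  have := integrable_conj_mul (Lp.memLp (φ j)) ((Lp.memLp (φ j)).comp_measurePreserving hs)
  exact this.congr (ae_of_all _ fun x => mul_comm _ _)

theorem corrFun_eq_integral {N : ℕ} (φ : Fin N → L2R) (s : ℝ) :
    corrFun φ s = ∫ x, sumKernel (fun j => φ j) (x + s) x := by
  refine tendsto_nhds_unique (tendsto_fourier_cutoffDensityFT_corrFun φ s) ?_
  simp_rw [fun n : ℕ => fourier_cutoffDensityFT (φ := φ) (memLp_iccInd (-(n : ℝ)) n 2)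
    (memLp_iccInd (-(n : ℝ)) n ∞) s]
  have hm : ∀ n : ℕ, Measurable (iccInd (-(n : ℝ)) n) :=
    fun n => measurable_one.indicator measurableSet_Icc
  refine tendsto_integral_of_dominated_convergence
    (fun x => ‖sumKernel (fun j => φ j) (x + s) x‖) ?_ (integrable_sumKernel_shift φ s).norm ?_ ?_
  · intro n
    refine AEStronglyMeasurable.mul ?_ (integrable_sumKernel_shift φ s).1
    exact (Complex.measurable_ofReal.comp
      ((hm n).mul ((hm n).comp (measurable_add_const s)))).aestronglyMeasurable
  · intro n
    refine ae_of_all _ fun x => ?_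
    by_cases hx : x ∈ Set.Icc (-(n : ℝ)) n <;> by_cases hx2 : x + s ∈ Set.Icc (-(n : ℝ)) n <;>
      simp [iccInd, hx, hx2]
  · refine ae_of_all _ fun x => ?_
    refine tendsto_const_nhds.congr' ?_
    obtain ⟨m, hm⟩ := exists_nat_ge (max |x| |x + s|)
    filter_upwards [eventually_ge_atTop m] with n hn
    have hn' : (m : ℝ) ≤ n := by exact_mod_cast hn
    have h1 : x ∈ Set.Icc (-(n : ℝ)) n := by
      rw [Set.mem_Icc, ← abs_le]
      exact (le_max_left _ _).trans (hm.trans hn')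
    have h2 : x + s ∈ Set.Icc (-(n : ℝ)) n := by
      rw [Set.mem_Icc, ← abs_le]
      exact (le_max_right _ _).trans (hm.trans hn')
    simp [iccInd, h1, h2]

theorem ae_eq_zero_of_intervalIntegral_eq_zero {f : ℝ → ℂ} (hf : LocallyIntegrable f volume)
    (h : ∀ a b, a ≤ b → ∫ x in a..b, f x = 0) : ∀ᵐ x, f x = 0 := by
  have h' : ∀ a b, ∫ x in a..b, f x = 0 := by
    intro a b
    rcases le_total a b with hab | hab
    · exact h a b hab
    · rw [intervalIntegral.integral_symm, h b a hab, neg_zero]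
  filter_upwards [LocallyIntegrable.ae_hasDerivAt_integral hf] with x hx
  have h1 := hx 0
  simp only [h'] at h1
  exact h1.unique (hasDerivAt_const x 0)

theorem tendsto_intervalIntegral_shift {g : ℝ → ℝ} (hg : Continuous g) {C : ℝ} (hC : ∀ x, |g x| ≤ C)
    {l : Filter ℝ} [l.IsCountablyGenerated] {L : ℝ} (hL : Tendsto g l (𝓝 L)) {u : ℕ → ℝ}
    (hu : ∀ x, Tendsto (fun n => x + u n) atTop l) (s : ℝ) :
    Tendsto (fun n => ∫ x in (u n)..(u n + s), g x) atTop (𝓝 (s * L)) := by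
  have h1 : ∀ n, ∫ x in (u n)..(u n + s), g x = ∫ x in (0 : ℝ)..s, g (x + u n) := by
    intro n
    rw [intervalIntegral.integral_comp_add_right, zero_add, add_comm s]
  simp_rw [h1]
  have h2 : s * L = ∫ x in (0 : ℝ)..s, L := by simp
  rw [h2]
  refine intervalIntegral.tendsto_integral_filter_of_dominated_convergence (fun _ => C) ?_ ?_ ?_ ?_
  · exact Eventually.of_forall fun n => (hg.comp (continuous_add_const _)).aestronglyMeasurable
  · exact Eventually.of_forall fun n => ae_of_all _ fun x _ => hC _
  · simp
  · exact ae_of_all _ fun x _ => hL.comp (hu x)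

theorem tendsto_integral_Iic_atTop {κ : ℝ → ℝ} (hκ : Integrable κ) :
    Tendsto (fun x => ∫ t in Set.Iic x, κ t) atTop (𝓝 (∫ t, κ t)) := by
  have h := (intervalIntegral_tendsto_integral_Ioi 0 hκ.integrableOn tendsto_id).const_add
    (∫ t in Set.Iic 0, κ t)
  have e : (∫ t in Set.Iic 0, κ t) + ∫ t in Set.Ioi 0, κ t = ∫ t, κ t :=
    intervalIntegral.integral_Iic_add_Ioi hκ.integrableOn hκ.integrableOn
  rw [e] at h
  refine h.congr fun x => ?_
  have := intervalIntegral.integral_Iic_sub_Iic (a := 0) (b := x) hκ.integrableOn hκ.integrableOn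
  simp only [id]; linarith

theorem tendsto_integral_Iic_atBot {κ : ℝ → ℝ} (hκ : Integrable κ) :
    Tendsto (fun x => ∫ t in Set.Iic x, κ t) atBot (𝓝 0) := by
  have h := (intervalIntegral_tendsto_integral_Iic 0 hκ.integrableOn tendsto_id).const_sub
    (∫ t in Set.Iic 0, κ t)
  rw [sub_self] at h
  refine h.congr fun x => ?_
  have := intervalIntegral.integral_Iic_sub_Iic (a := x) (b := 0) hκ.integrableOn hκ.integrableOn
  simp only [id]; linarith

theorem continuous_integral_Iic {κ : ℝ → ℝ} (hκ : Integrable κ) :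
    Continuous (fun x => ∫ t in Set.Iic x, κ t) := by
  have h : (fun x => ∫ t in Set.Iic x, κ t) =
      fun x => (∫ t in Set.Iic 0, κ t) + ∫ t in (0 : ℝ)..x, κ t := by
    ext x
    have := intervalIntegral.integral_Iic_sub_Iic (a := 0) (b := x) hκ.integrableOn hκ.integrableOn
    linarith
  rw [h]
  exact continuous_const.add (intervalIntegral.continuous_primitive (fun _ _ => hκ.intervalIntegrable) 0)

theorem sumKernel_conj {N : ℕ} (φ : Fin N → ℝ → ℂ) (x y : ℝ) :
    conj (sumKernel φ x y) = sumKernel φ y x := by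
  simp [sumKernel, mul_comm]

theorem conj_corrFun {N : ℕ} (φ : Fin N → L2R) (s : ℝ) : conj (corrFun φ s) = corrFun φ (-s) := by
  rw [corrFun, corrFun, Real.fourier_real_eq, Real.fourier_real_eq, ← integral_conj]
  congr 1; ext x
  simp only [Circle.smul_def, smul_eq_mul, map_mul, Complex.conj_ofReal, ← Circle.coe_inv_eq_conj,
    ← AddChar.map_neg_eq_inv]
  simp

/-- The second cutoff in `IsCommRep.cutoff_comm` is the indicator of `[-n, n]` with `n → ∞`: its
difference integral tends to `s (gTop - gBot)`, coming from the two end intervals of length `s`. -/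
theorem IsCommRep.cutoff_corrFun {N : ℕ} {F g : ℝ → ℝ} {hF : MemLp F ∞ (volume : Measure ℝ)}
    {hg : MemLp g ∞ (volume : Measure ℝ)} {φ : Fin N → L2R} (h : IsCommRep F g hF hg φ)
    (hgc : Continuous g) {C gBot gTop : ℝ} (hC : ∀ x, |g x| ≤ C)
    (hBot : Tendsto g atBot (𝓝 gBot)) (hTop : Tendsto g atTop (𝓝 gTop)) {s : ℝ} (hs : 0 ≤ s)
    (a b : ℝ) : 𝓕 (cutoffDensityFT φ (iccInd a b)) (-s) * (s * (gTop - gBot) : ℝ) = corrFun φ s *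
      (∫ x, iccInd a b x * iccInd a b (x + s) * (g (x + s) - g x) : ℝ) := by
  have t1 := (tendsto_fourier_cutoffDensityFT_corrFun φ s).mul_const
    ((∫ x, iccInd a b x * iccInd a b (x + s) * (g (x + s) - g x) : ℝ) : ℂ)
  have t2 : Tendsto (fun n : ℕ => ∫ x, iccInd (-(n : ℝ)) n x * iccInd (-(n : ℝ)) n (x + s) *
      (g (x + s) - g x)) atTop (𝓝 (s * gTop - s * gBot)) := by
    have a1 := tendsto_intervalIntegral_shift hgc hC hTop (u := fun n => n - s)
      (fun x => by
        have := tendsto_atTop_add_const_right atTop (x - s) (tendsto_natCast_atTop_atTop (R := ℝ))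
        refine this.congr fun n => by ring) s
    have a2 := tendsto_intervalIntegral_shift hgc hC hBot (u := fun n => -(n : ℝ))
      (fun x => tendsto_atBot_add_const_left atTop x
        (tendsto_neg_atTop_atBot.comp tendsto_natCast_atTop_atTop)) s
    refine (a1.sub a2).congr' ?_
    obtain ⟨m, hm⟩ := exists_nat_ge s
    filter_upwards [eventually_ge_atTop m] with n hn
    have hn' : (m : ℝ) ≤ n := by exact_mod_cast hn
    have : (0 : ℝ) ≤ n := n.cast_nonneg
    rw [integral_iccInd_diff hg hs (by linarith)]
    simp
  have t3 := ((Complex.continuous_ofReal.tendsto _).comp t2).const_mul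
    (𝓕 (cutoffDensityFT φ (iccInd a b)) (-s))
  rw [mul_sub]
  refine tendsto_nhds_unique t3 (t1.congr fun n => ?_)
  exact (h.cutoff_comm (integrable_iccInd a b) (memLp_iccInd a b 2) (memLp_iccInd a b ∞)
    (integrable_iccInd _ _) (memLp_iccInd _ _ 2) (memLp_iccInd _ _ ∞) s).symm

/-- The interval in `IsCommRep.cutoff_corrFun` is arbitrary, so the integrands agree almost
everywhere. -/
theorem IsCommRep.sumKernel_shift {N : ℕ} {F g : ℝ → ℝ} {hF : MemLp F ∞ (volume : Measure ℝ)}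
    {hg : MemLp g ∞ (volume : Measure ℝ)} {φ : Fin N → L2R} (h : IsCommRep F g hF hg φ)
    (hgc : Continuous g) {C gBot gTop : ℝ} (hC : ∀ x, |g x| ≤ C)
    (hBot : Tendsto g atBot (𝓝 gBot)) (hTop : Tendsto g atTop (𝓝 gTop)) {s : ℝ} (hs : 0 ≤ s) :
    ∀ᵐ x, (s * (gTop - gBot) : ℝ) * sumKernel (fun j => φ j) (x + s) x =
      corrFun φ s * (g (x + s) - g x : ℝ) := by
  have hKi := integrable_sumKernel_shift φ s
  have := ae_eq_zero_of_intervalIntegral_eq_zero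
    (f := fun x => (s * (gTop - gBot) : ℝ) * sumKernel (fun j => φ j) (x + s) x -
      corrFun φ s * (g (x + s) - g x : ℝ))
    ((hKi.const_mul _).locallyIntegrable.sub (by
      refine Continuous.locallyIntegrable ?_
      fun_prop)) ?_
  · filter_upwards [this] with x hx
    exact sub_eq_zero.1 hx
  · intro a b hab
    -- The right end `b + s` makes the overlap of the interval with its shift exactly `[a, b]`.
    have e := h.cutoff_corrFun hgc hC hBot hTop hs a (b + s)
    rw [fourier_cutoffDensityFT_iccInd φ a (b + s) hs] at e
    simp_rw [iccInd_mul_iccInd_add hs] at e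
    have e2 := integral_iccInd_mul a (b + s - s) (fun x => (g (x + s) - g x))
    simp only [smul_eq_mul] at e2
    rw [e2] at e
    simp only [add_sub_cancel_right] at e
    rw [integral_Icc_eq_integral_Ioc, integral_Icc_eq_integral_Ioc,
      ← intervalIntegral.integral_of_le hab, ← intervalIntegral.integral_of_le hab,
      ← intervalIntegral.integral_ofReal] at e
    rw [intervalIntegral.integral_sub, intervalIntegral.integral_const_mul,
      intervalIntegral.integral_const_mul, ← e]
    · ring
    · exact (hKi.const_mul _).intervalIntegrable
    · refine Continuous.intervalIntegrable ?_ _ _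
      fun_prop

theorem IsCommRep.sumKernel_ae {N : ℕ} {F g : ℝ → ℝ} {hF : MemLp F ∞ (volume : Measure ℝ)}
    {hg : MemLp g ∞ (volume : Measure ℝ)} {φ : Fin N → L2R} (h : IsCommRep F g hF hg φ)
    (hgc : Continuous g) {C gBot gTop : ℝ} (hC : ∀ x, |g x| ≤ C)
    (hBot : Tendsto g atBot (𝓝 gBot)) (hTop : Tendsto g atTop (𝓝 gTop)) :
    ∀ᵐ x, ∀ᵐ y, ((x - y) * (gTop - gBot) : ℝ) * sumKernel (fun j => φ j) x y =
      corrFun φ (x - y) * (g x - g y : ℝ) := by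
  have hall : ∀ s, ∀ᵐ x, (s * (gTop - gBot) : ℝ) * sumKernel (fun j => φ j) (x + s) x =
      corrFun φ s * (g (x + s) - g x : ℝ) := by
    intro s
    rcases le_total 0 s with hs | hs
    · exact h.sumKernel_shift hgc hC hBot hTop hs
    · have h1 := h.sumKernel_shift hgc hC hBot hTop (neg_nonneg.2 hs)
      have h2 := (measurePreserving_add_right (volume : Measure ℝ) s).quasiMeasurePreserving.ae h1
      filter_upwards [h2] with x hx
      have h3 := congrArg (starRingEnd ℂ) hx
      simp only [map_mul, sumKernel_conj, conj_corrFun, Complex.conj_ofReal, add_neg_cancel_right,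
        neg_neg] at h3
      push_cast at h3 ⊢
      linear_combination -h3
  have hm : ∀ j, Measurable (φ j : ℝ → ℂ) := fun j => (Lp.stronglyMeasurable (φ j)).measurable
  have hΓ := (continuous_corrFun φ).measurable
  have hgm := hgc.measurable
  have hset : MeasurableSet {p : ℝ × ℝ | (p.1 * (gTop - gBot) : ℝ) *
      sumKernel (fun j => φ j) (p.2 + p.1) p.2 = corrFun φ p.1 * (g (p.2 + p.1) - g p.2 : ℝ)} := by
    refine measurableSet_eq_fun ?_ ?_
    · unfold sumKernel
      fun_prop
    · fun_prop
  -- Fubini turns "for every `s`, for almost every `x`" into "for almost every `x`, for almost every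
  -- `s`"; then `s = y - x`, and conjugation exchanges the arguments of the kernel.
  have h2 := (Measure.ae_ae_comm (μ := volume) (ν := volume) (p := fun s x : ℝ => (s * (gTop - gBot) : ℝ) *
      sumKernel (fun j => φ j) (x + s) x = corrFun φ s * (g (x + s) - g x : ℝ)) hset).1 (ae_of_all _ hall)
  filter_upwards [h2] with x hx
  have h3 := (measurePreserving_sub_right (volume : Measure ℝ) x).quasiMeasurePreserving.ae hx
  filter_upwards [h3] with y hy
  have h4 := congrArg (starRingEnd ℂ) hy
  simp only [map_mul, sumKernel_conj, conj_corrFun, Complex.conj_ofReal, add_sub_cancel, neg_sub] at h4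
  push_cast at h4 ⊢
  linear_combination -h4

/-! ### Continuity of the eigenfunctions. -/

/-- The Gram matrices of the restrictions to `Y n` converge to the Gram matrix of `φ`, which is
invertible by linear independence. For a suitable `n` the inverse yields functions dual to `φ` and
supported in `Y n`. -/
theorem exists_dual_family {N : ℕ} {φ : Fin N → L2R} (hφ : LinearIndependent ℂ φ) {Y : ℕ → Set ℝ}
    (hY : ∀ n, MeasurableSet (Y n)) (hYfin : ∀ n, volume (Y n) ≠ ∞)
    (hYae : ∀ᵐ x, ∀ᶠ n in atTop, x ∈ Y n) :
    ∃ (n : ℕ) (χ : Fin N → ℝ → ℂ), (∀ i, Integrable (χ i)) ∧ (∀ i, ∀ x ∉ Y n, χ i x = 0) ∧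
      (∀ i j, Integrable fun y => conj (φ j y) * χ i y) ∧
      ∀ i j, ∫ y, conj (φ j y) * χ i y = if j = i then 1 else 0 := by
  have hint : ∀ i j, Integrable (fun x => conj (φ i x) * φ j x) := fun i j =>
    integrable_conj_mul (Lp.memLp (φ i)) (Lp.memLp (φ j))
  set M : ℕ → Matrix (Fin N) (Fin N) ℂ := fun n i j => ∫ x in Y n, conj (φ i x) * φ j x with hM
  have hlim : Tendsto M atTop (𝓝 (Matrix.gram ℂ φ)) := by
    refine tendsto_pi_nhds.2 fun i => tendsto_pi_nhds.2 fun j => ?_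
    simp only [hM, Matrix.gram_apply, inner_L2R]
    simp_rw [← integral_indicator (hY _)]
    refine tendsto_integral_of_dominated_convergence (fun x => ‖conj (φ i x) * φ j x‖)
      (fun n => ((hint i j).indicator (hY n)).1) (hint i j).norm
      (fun n => ae_of_all _ fun x => norm_indicator_le_norm_self _ _) ?_
    filter_upwards [hYae] with x hx
    refine tendsto_const_nhds.congr' ?_
    filter_upwards [hx] with n hn
    rw [Set.indicator_of_mem hn]
  have hdet : (Matrix.gram ℂ φ).det ≠ 0 := Matrix.det_gram_ne_zero_iff_linearIndependent.2 hφ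
  have hdetlim : Tendsto (fun n => (M n).det) atTop (𝓝 (Matrix.gram ℂ φ).det) :=
    ((continuous_id.matrix_det).tendsto _).comp hlim
  obtain ⟨n, hn⟩ := (hdetlim.eventually_ne hdet).exists
  have hpart : ∀ i j, Integrable ((Y n).indicator fun x => conj (φ i x) * φ j x) :=
    fun i j => (hint i j).indicator (hY n)
  have hsum : ∀ i j y, conj (φ j y) * (∑ k, (M n)⁻¹ k i * (Y n).indicator (φ k) y) =
      ∑ k, (M n)⁻¹ k i * (Y n).indicator (fun x => conj (φ j x) * φ k x) y := by
    intro i j y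
    rw [Finset.mul_sum]
    refine Finset.sum_congr rfl fun k _ => ?_
    by_cases hy : y ∈ Y n
    · simp only [Set.indicator_of_mem hy]; ring
    · simp only [Set.indicator_of_notMem hy]; ring
  refine ⟨n, fun i y => ∑ k, (M n)⁻¹ k i * (Y n).indicator (φ k) y, ?_, ?_, ?_, ?_⟩
  · intro i
    refine integrable_finsetSum _ fun k _ => Integrable.const_mul ?_ _
    rw [integrable_indicator_iff (hY n)]
    have : IsFiniteMeasure (volume.restrict (Y n)) := ⟨by simpa using (hYfin n).lt_top⟩
    exact ((Lp.memLp (φ k)).restrict (Y n)).integrable (by norm_num)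
  · intro i x hx
    simp [Set.indicator_of_notMem hx]
  · intro i j
    simp_rw [hsum]
    exact integrable_finsetSum _ fun k _ => (hpart j k).const_mul _
  · intro i j
    simp_rw [hsum]
    rw [integral_finsetSum _ fun k _ => (hpart j k).const_mul _]
    simp_rw [integral_const_mul, integral_indicator (hY n)]
    have : (M n * (M n)⁻¹) j i = if j = i then 1 else 0 := by
      rw [Matrix.mul_nonsing_inv _ (isUnit_iff_ne_zero.2 hn), Matrix.one_apply]
    rw [← this, Matrix.mul_apply]
    exact Finset.sum_congr rfl fun k _ => mul_comm _ _

/-- The annulus `{1/(n+1) ≤ |y - x₀| ≤ n + 1}`. -/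
def annulus (x₀ : ℝ) (n : ℕ) : Set ℝ := {y | 1 / ((n : ℝ) + 1) ≤ |y - x₀| ∧ |y - x₀| ≤ n + 1}

theorem isClosed_annulus (x₀ : ℝ) (n : ℕ) : IsClosed (annulus x₀ n) :=
  have hc : Continuous fun y : ℝ => |y - x₀| := by fun_prop
  (isClosed_le continuous_const hc).inter (isClosed_le hc continuous_const)

theorem volume_annulus_ne_top (x₀ : ℝ) (n : ℕ) : volume (annulus x₀ n) ≠ ∞ := by
  refine ne_top_of_le_ne_top (b := volume (Metric.closedBall x₀ ((n : ℝ) + 1)))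
    (isCompact_closedBall _ _).measure_lt_top.ne (measure_mono fun y hy => ?_)
  simpa [Real.dist_eq] using hy.2

theorem eventually_mem_annulus {x₀ x : ℝ} (hx : x ≠ x₀) : ∀ᶠ n in atTop, x ∈ annulus x₀ n := by
  have hpos : 0 < |x - x₀| := abs_pos.2 (sub_ne_zero.2 hx)
  have h1 := (tendsto_one_div_add_atTop_nhds_zero_nat (𝕜 := ℝ)).eventually_le_const hpos
  have h2 := (tendsto_natCast_atTop_atTop (R := ℝ)).eventually_ge_atTop (|x - x₀|)
  filter_upwards [h1, h2] with n a b
  exact ⟨a, by linarith⟩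

/-- An integral operator with kernel `Γ(x - y)(g(x) - g(y)) / ((x - y) Δ)`. -/
noncomputable def diffQuotOp (Γ : ℝ → ℂ) (g : ℝ → ℝ) (Δ : ℝ) (χ : ℝ → ℂ) (x : ℝ) : ℂ :=
  ∫ y, Γ (x - y) * (g x - g y : ℝ) / ((x - y) * Δ : ℝ) * χ y

/-- Integrating the kernel against the dual function `χ i` isolates `φ i`. The annulus keeps `y`
away from `x₀`, where the factor `1/(x - y)` is singular, and also bounded, which serves the decay
estimate. -/
theorem exists_diffQuotOp_eq {N : ℕ} {φ : Fin N → L2R} (hφ : LinearIndependent ℂ φ) {Γ : ℝ → ℂ}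
    {g : ℝ → ℝ} {Δ : ℝ} (hΔ : Δ ≠ 0)
    (hK : ∀ᵐ x, ∀ᵐ y, ((x - y) * Δ : ℝ) * sumKernel (fun j => φ j) x y = Γ (x - y) * (g x - g y : ℝ))
    (x₀ : ℝ) : ∃ (n : ℕ) (χ : Fin N → ℝ → ℂ), (∀ i, Integrable (χ i)) ∧
      (∀ i, ∀ x ∉ annulus x₀ n, χ i x = 0) ∧ ∀ i, ∀ᵐ x, φ i x = diffQuotOp Γ g Δ (χ i) x := by
  obtain ⟨n, χ, h1, h2, h3, h4⟩ := exists_dual_family hφ (Y := annulus x₀)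
    (fun n => (isClosed_annulus x₀ n).measurableSet) (volume_annulus_ne_top x₀) (by
      have : ∀ᵐ x : ℝ, x ≠ x₀ := by simp [ae_iff]
      filter_upwards [this] with x hx
      exact eventually_mem_annulus hx)
  refine ⟨n, χ, h1, h2, fun i => ?_⟩
  filter_upwards [hK] with x hx
  have e1 : φ i x = ∫ y, sumKernel (fun j => φ j) x y * χ i y := by
    have : ∀ y, sumKernel (fun j => φ j) x y * χ i y = ∑ j, φ j x * (conj (φ j y) * χ i y) := by
      intro y
      rw [sumKernel, Finset.sum_mul]
      exact Finset.sum_congr rfl fun j _ => mul_assoc _ _ _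
    simp_rw [this]
    rw [integral_finsetSum _ fun j _ => (h3 i j).const_mul _]
    simp_rw [integral_const_mul, h4]
    simp
  rw [e1, diffQuotOp]
  apply integral_congr_ae
  have hne : ∀ᵐ y : ℝ, y ≠ x := by simp [ae_iff]
  filter_upwards [hx, hne] with y hy hyx
  rw [← hy, mul_div_cancel_left₀]
  have : x - y ≠ 0 := sub_ne_zero.2 hyx.symm
  exact_mod_cast mul_ne_zero this hΔ

theorem norm_diffQuot_le {Γ : ℝ → ℂ} {g : ℝ → ℝ} {Δ A C ε x y : ℝ} (hA : ‖Γ (x - y)‖ ≤ A)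
    (hC : ∀ x, |g x| ≤ C) (hε : 0 < ε) (hxy : ε ≤ |x - y|) :
    ‖Γ (x - y) * (g x - g y : ℝ) / ((x - y) * Δ : ℝ)‖ ≤ A * (2 * C / |Δ|) / ε := by
  have hC0 : 0 ≤ C := (abs_nonneg _).trans (hC 0)
  have hA0 : 0 ≤ A := (norm_nonneg _).trans hA
  have h1 : |g x - g y| ≤ 2 * C := by
    have := abs_sub (g x) (g y)
    linarith [hC x, hC y]
  rw [norm_div, norm_mul, Complex.norm_real, Complex.norm_real, Real.norm_eq_abs, Real.norm_eq_abs,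
    abs_mul]
  calc ‖Γ (x - y)‖ * |g x - g y| / (|x - y| * |Δ|)
      = ‖Γ (x - y)‖ * (|g x - g y| / |Δ|) / |x - y| := by
        rw [mul_comm |x - y|, ← div_div, mul_div_assoc]
    _ ≤ A * (2 * C / |Δ|) / ε := by gcongr

theorem continuousOn_diffQuotOp {Γ : ℝ → ℂ} (hΓ : Continuous Γ) {A : ℝ} (hA : ∀ s, ‖Γ s‖ ≤ A)
    {g : ℝ → ℝ} (hg : Continuous g) {C : ℝ} (hC : ∀ x, |g x| ≤ C) {Δ : ℝ} (hΔ : Δ ≠ 0) {χ : ℝ → ℂ}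
    (hχ : Integrable χ) {x₀ ε : ℝ} (hε : 0 < ε) (h0 : ∀ y, |y - x₀| < ε → χ y = 0) :
    ContinuousOn (diffQuotOp Γ g Δ χ) (Metric.ball x₀ (ε / 2)) := by
  have hdist : ∀ x ∈ Metric.ball x₀ (ε / 2), ∀ y, χ y ≠ 0 → ε / 2 ≤ |x - y| := by
    intro x hx y hy
    have h1 : ε ≤ |y - x₀| := not_lt.1 fun h => hy (h0 y h)
    rw [Metric.mem_ball, Real.dist_eq] at hx
    have := abs_sub_le y x x₀
    rw [abs_sub_comm y x] at this
    linarith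
  refine continuousOn_of_dominated (bound := fun y => A * (2 * C / |Δ|) / (ε / 2) * ‖χ y‖) ?_ ?_
    (hχ.norm.const_mul _) ?_
  · intro x _
    refine AEStronglyMeasurable.mul (Measurable.aestronglyMeasurable ?_) hχ.1
    have := hΓ.measurable
    have := hg.measurable
    fun_prop
  · intro x hx
    refine ae_of_all _ fun y => ?_
    rw [norm_mul]
    by_cases hy : χ y = 0
    · simp [hy]
    · gcongr
      exact norm_diffQuot_le (hA _) hC (half_pos hε) (hdist x hx y hy)
  · refine ae_of_all _ fun y => ?_
    by_cases hy : χ y = 0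
    · simp only [hy, mul_zero]; exact continuousOn_const
    · refine ContinuousOn.mul (ContinuousOn.div ?_ ?_ ?_) continuousOn_const
      · exact Continuous.continuousOn (by fun_prop)
      · exact Continuous.continuousOn (by fun_prop)
      · intro x hx
        have h1 := hdist x hx y hy
        have h2 : x - y ≠ 0 := abs_pos.1 ((half_pos hε).trans_le h1)
        exact_mod_cast mul_ne_zero h2 hΔ

/-- Two local continuous versions agree on the overlap of their balls, so they glue. -/
theorem exists_continuous_ae_eq {φ : ℝ → ℂ}
    (h : ∀ x₀, ∃ ε > 0, ∃ θ : ℝ → ℂ, ContinuousOn θ (Metric.ball x₀ ε) ∧ ∀ᵐ x, φ x = θ x) :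
    ∃ Φ : ℝ → ℂ, Continuous Φ ∧ Φ =ᵐ[volume] φ := by
  choose ε hε θ hθ hae using h
  have hloc : ∀ x₀, ∀ x ∈ Metric.ball x₀ (ε x₀), θ x x = θ x₀ x := by
    intro x₀ x hx
    have hU : IsOpen (Metric.ball x₀ (ε x₀) ∩ Metric.ball x (ε x)) :=
      Metric.isOpen_ball.inter Metric.isOpen_ball
    refine Measure.eqOn_open_of_ae_eq (μ := volume) (f := θ x) (g := θ x₀) ?_ hU
      ((hθ x).mono Set.inter_subset_right) ((hθ x₀).mono Set.inter_subset_left)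
      ⟨hx, Metric.mem_ball_self (hε x)⟩
    refine ae_restrict_of_ae ?_
    filter_upwards [hae x, hae x₀] with y h1 h2
    rw [← h1, h2]
  refine ⟨fun x => θ x x, ?_, ?_⟩
  · rw [continuous_iff_continuousAt]
    intro x₀
    have h1 : ContinuousAt (θ x₀) x₀ := (hθ x₀).continuousAt (Metric.ball_mem_nhds _ (hε x₀))
    refine h1.congr ?_
    filter_upwards [Metric.ball_mem_nhds x₀ (hε x₀)] with x hx
    exact (hloc x₀ x hx).symm
  · rw [EventuallyEq, ae_iff]
    refine measure_null_of_locally_null _ fun x₀ _ => ?_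
    refine ⟨{x | ¬ θ x x = φ x} ∩ Metric.ball x₀ (ε x₀),
      inter_mem_nhdsWithin _ (Metric.ball_mem_nhds x₀ (hε x₀)), ?_⟩
    refine measure_mono_null ?_ (ae_iff.1 (hae x₀))
    rintro x ⟨h1, h2⟩ h3
    exact h1 ((hloc x₀ x h2).trans h3.symm)

theorem exists_continuous_version {N : ℕ} {φ : Fin N → L2R} (hφ : LinearIndependent ℂ φ) {Γ : ℝ → ℂ}
    (hΓ : Continuous Γ) {A : ℝ} (hA : ∀ s, ‖Γ s‖ ≤ A) {g : ℝ → ℝ} (hg : Continuous g)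
    {C : ℝ} (hC : ∀ x, |g x| ≤ C) {Δ : ℝ} (hΔ : Δ ≠ 0)
    (hK : ∀ᵐ x, ∀ᵐ y, ((x - y) * Δ : ℝ) * sumKernel (fun j => φ j) x y =
      Γ (x - y) * (g x - g y : ℝ)) :
    ∃ Φ : Fin N → ℝ → ℂ, ∀ j, Continuous (Φ j) ∧ Φ j =ᵐ[volume] φ j := by
  have : ∀ j, ∃ Φ : ℝ → ℂ, Continuous Φ ∧ Φ =ᵐ[volume] φ j := by
    intro j
    refine exists_continuous_ae_eq fun x₀ => ?_
    obtain ⟨n, χ, h1, h2, h3⟩ := exists_diffQuotOp_eq hφ hΔ hK x₀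
    have hn : 0 < 1 / ((n : ℝ) + 1) := by positivity
    refine ⟨1 / ((n : ℝ) + 1) / 2, half_pos hn, diffQuotOp Γ g Δ (χ j), ?_, h3 j⟩
    refine continuousOn_diffQuotOp hΓ hA hg hC hΔ (h1 j) hn fun y hy => h2 j y fun hmem => ?_
    exact absurd hmem.1 (not_le.2 hy)
  choose Φ hΦ using this
  exact ⟨Φ, hΦ⟩

/-! ### Positivity of the density. -/

section kernel

variable {N : ℕ} {φ : Fin N → L2R} {Φ : Fin N → ℝ → ℂ} {Γ : ℝ → ℂ} {g : ℝ → ℝ} {Δ : ℝ}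

theorem sumKernel_eq_of_ae (hΦ : ∀ j, Continuous (Φ j)) (hΦφ : ∀ j, Φ j =ᵐ[volume] φ j)
    (hΓ : Continuous Γ) (hg : Continuous g)
    (hK : ∀ᵐ x, ∀ᵐ y, ((x - y) * Δ : ℝ) * sumKernel (fun j => φ j) x y =
      Γ (x - y) * (g x - g y : ℝ)) (x y : ℝ) :
    ((x - y) * Δ : ℝ) * sumKernel Φ x y = Γ (x - y) * (g x - g y : ℝ) := by
  have hall := ae_all_iff.2 hΦφ
  have h1 : ∀ᵐ x, ∀ y, ((x - y) * Δ : ℝ) * sumKernel Φ x y = Γ (x - y) * (g x - g y : ℝ) := by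
    filter_upwards [hK, hall] with x hx hx2
    refine congrFun ((Continuous.ae_eq_iff_eq volume ?_ ?_).1 ?_)
    · unfold sumKernel; fun_prop
    · fun_prop
    · filter_upwards [hx, hall] with y hy hy2
      simp only [sumKernel, hx2, hy2] at hy ⊢
      exact hy
  refine congrFun ((Continuous.ae_eq_iff_eq (f := fun x => ((x - y) * Δ : ℝ) * sumKernel Φ x y)
    (g := fun x => Γ (x - y) * (g x - g y : ℝ)) volume ?_ ?_).1 ?_) x
  · unfold sumKernel; fun_prop
  · fun_prop
  · filter_upwards [h1] with x hx using hx y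

theorem continuous_density (hΦ : ∀ j, Continuous (Φ j)) : Continuous (density Φ) := by
  unfold density; fun_prop

/-- The zero set is closed. It is open because at a zero `x₀` all `Φ j` vanish, so `Γ (x₀ - y) (g x₀
- g y) = 0` for all `y`; as `Γ` is non-zero near `0`, `g` is constant near `x₀`, and its derivative
`c * density Φ` vanishes there. Connectedness concludes. -/
theorem density_pos (hΦ : ∀ j, Continuous (Φ j)) (hΓ : Continuous Γ) (hΓ0 : Γ 0 ≠ 0)
    (hK : ∀ x y, ((x - y) * Δ : ℝ) * sumKernel Φ x y = Γ (x - y) * (g x - g y : ℝ))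
    {c : ℝ} (hc : c ≠ 0) (hg : ∀ x, HasDerivAt g (c * density Φ x) x)
    (hne : ∃ x, density Φ x ≠ 0) (x : ℝ) : 0 < density Φ x := by
  refine lt_of_le_of_ne (density_nonneg _ _) fun h0 => ?_
  have hclosed : IsClosed {x | density Φ x = 0} :=
    isClosed_eq (continuous_density hΦ) continuous_const
  have hopen : IsOpen {x | density Φ x = 0} := by
    rw [isOpen_iff_mem_nhds]
    intro x₀ hx₀
    have hz : ∀ j, Φ j x₀ = 0 := fun j => by
      have := (Finset.sum_eq_zero_iff_of_nonneg (fun i _ => by positivity)).1 hx₀ j (Finset.mem_univ j)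
      simpa using this
    have hev : ∀ᶠ y in 𝓝 x₀, Γ (x₀ - y) ≠ 0 := by
      have : Continuous fun y => Γ (x₀ - y) := by fun_prop
      refine this.continuousAt.eventually_ne ?_
      simpa using hΓ0
    have hev2 : ∀ᶠ y in 𝓝 x₀, g y = g x₀ := by
      filter_upwards [hev] with y hy
      have := hK x₀ y
      simp only [sumKernel, hz, zero_mul, Finset.sum_const_zero, mul_zero] at this
      rcases mul_eq_zero.1 this.symm with h | h
      · exact absurd h hy
      · have : g x₀ - g y = 0 := by exact_mod_cast h
        linarith
    filter_upwards [hev2.eventually_nhds] with y hy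
    have h1 : HasDerivAt g 0 y := (hasDerivAt_const y (g x₀)).congr_of_eventuallyEq hy
    have := (hg y).unique h1
    exact (mul_eq_zero.1 this).resolve_left hc
  have := IsClopen.eq_univ ⟨hclosed, hopen⟩ ⟨x, h0.symm⟩
  obtain ⟨y, hy⟩ := hne
  exact hy (this ▸ Set.mem_univ y : y ∈ {x | density Φ x = 0})

end kernel

/-! ### Rapid decay by iteration. -/

/-- The weight `(1 + |x|)^{1/4}`. -/
noncomputable def quarterWeight (x : ℝ) : ℝ := (1 + |x|) ^ (1 / 4 : ℝ)

theorem one_le_quarterWeight (x : ℝ) : 1 ≤ quarterWeight x :=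
  Real.one_le_rpow (by linarith [abs_nonneg x]) (by norm_num)

theorem quarterWeight_pos (x : ℝ) : 0 < quarterWeight x :=
  zero_lt_one.trans_le (one_le_quarterWeight x)

theorem quarterWeight_neg (x : ℝ) : quarterWeight (-x) = quarterWeight x := by
  simp [quarterWeight]

theorem quarterWeight_mono {x y : ℝ} (h : |x| ≤ |y|) : quarterWeight x ≤ quarterWeight y := by
  unfold quarterWeight; gcongr

theorem quarterWeight_add_le (x y : ℝ) :
    quarterWeight (x + y) ≤ quarterWeight x * quarterWeight y := by
  unfold quarterWeight
  rw [← Real.mul_rpow (by positivity) (by positivity)]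
  refine Real.rpow_le_rpow (by positivity) ?_ (by norm_num)
  nlinarith [abs_add_le x y, abs_nonneg x, abs_nonneg y, mul_nonneg (abs_nonneg x) (abs_nonneg y)]

theorem quarterWeight_pow_four (x : ℝ) : quarterWeight x ^ 4 = 1 + |x| := by
  unfold quarterWeight
  rw [← Real.rpow_natCast, ← Real.rpow_mul (by positivity)]
  norm_num

theorem continuous_quarterWeight : Continuous quarterWeight := by
  unfold quarterWeight
  exact Continuous.rpow_const (by fun_prop) fun x => Or.inr (by norm_num)

theorem integrable_quarterWeight_inv : Integrable fun x => (quarterWeight x ^ 6)⁻¹ := by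
  have h := integrable_one_add_norm (E := ℝ) (μ := volume) (r := 3 / 2) (by norm_num)
  refine h.congr (ae_of_all _ fun x => ?_)
  simp only [quarterWeight, Real.norm_eq_abs]
  rw [← Real.rpow_natCast, ← Real.rpow_mul (by positivity), ← Real.rpow_neg (by positivity)]
  norm_num

section decay

variable {N : ℕ} {φ : Fin N → L2R} {Φ : Fin N → ℝ → ℂ} {Γ : ℝ → ℂ} {g : ℝ → ℝ} {Δ : ℝ}

/-- The weight is even and submultiplicative, so `w(s) ≤ w(x+s) w(x)`; distribute it over the two
factors of the kernel and apply `2ab ≤ a² + b²`. -/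
theorem norm_corr_le {k : ℕ} (hΓ : ∀ s, Γ s = ∫ x, sumKernel Φ (x + s) x)
    (hi : Integrable fun x => quarterWeight x ^ (2 * k) * density Φ x) (s : ℝ) :
    ‖Γ s‖ * quarterWeight s ^ k ≤ ∫ x, quarterWeight x ^ (2 * k) * density Φ x := by
  set I := fun x => quarterWeight x ^ (2 * k) * density Φ x with hI
  have hb : ∀ x, quarterWeight s ^ k * ‖sumKernel Φ (x + s) x‖ ≤ (I (x + s) + I x) / 2 := by
    intro x
    have h1 : quarterWeight s ≤ quarterWeight (x + s) * quarterWeight x := by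
      have := quarterWeight_add_le (x + s) (-x)
      rwa [quarterWeight_neg, show x + s + -x = s by ring] at this
    have h2 : quarterWeight s ^ k ≤ quarterWeight (x + s) ^ k * quarterWeight x ^ k := by
      rw [← mul_pow]
      exact pow_le_pow_left₀ (quarterWeight_pos s).le h1 k
    have h3 : ‖sumKernel Φ (x + s) x‖ ≤ ∑ j, ‖Φ j (x + s)‖ * ‖Φ j x‖ := by
      refine (norm_sum_le _ _).trans (le_of_eq ?_)
      simp
    have h4 : (I (x + s) + I x) / 2 = ∑ j, ((quarterWeight (x + s) ^ k * ‖Φ j (x + s)‖) ^ 2 +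
        (quarterWeight x ^ k * ‖Φ j x‖) ^ 2) / 2 := by
      simp only [hI, density, Finset.mul_sum]
      rw [← Finset.sum_add_distrib, Finset.sum_div]
      refine Finset.sum_congr rfl fun j _ => ?_
      rw [mul_pow, mul_pow, ← pow_mul, ← pow_mul, mul_comm k 2]
    rw [h4]
    calc quarterWeight s ^ k * ‖sumKernel Φ (x + s) x‖
        ≤ (quarterWeight (x + s) ^ k * quarterWeight x ^ k) * ∑ j, ‖Φ j (x + s)‖ * ‖Φ j x‖ := by
          have := (quarterWeight_pos (x + s)).le
          have := (quarterWeight_pos x).le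
          gcongr
      _ = ∑ j, (quarterWeight (x + s) ^ k * ‖Φ j (x + s)‖) * (quarterWeight x ^ k * ‖Φ j x‖) := by
          rw [Finset.mul_sum]
          exact Finset.sum_congr rfl fun j _ => by ring
      _ ≤ _ := by
          refine Finset.sum_le_sum fun j _ => ?_
          nlinarith [sq_nonneg ((quarterWeight (x + s) ^ k * ‖Φ j (x + s)‖) -
            (quarterWeight x ^ k * ‖Φ j x‖))]
  have hi2 : Integrable fun x => I (x + s) := hi.comp_add_right s
  calc ‖Γ s‖ * quarterWeight s ^ k
      = ‖∫ x, ((quarterWeight s ^ k : ℝ) : ℂ) * sumKernel Φ (x + s) x‖ := by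
        rw [integral_const_mul, norm_mul, ← hΓ, Complex.norm_real, Real.norm_eq_abs, abs_of_nonneg, mul_comm]
        exact pow_nonneg (quarterWeight_pos s).le _
    _ ≤ ∫ x, (I (x + s) + I x) / 2 := by
        refine norm_integral_le_of_norm_le ((hi2.add hi).div_const 2) (ae_of_all _ fun x => ?_)
        rw [norm_mul, Complex.norm_real, Real.norm_eq_abs, abs_of_nonneg]
        · exact hb x
        · exact pow_nonneg (quarterWeight_pos s).le _
    _ = ∫ x, I x := by
        rw [integral_div, integral_add hi2 hi, integral_add_right_eq_self]
        ring

theorem norm_le_of_ae_le {f : ℝ → ℂ} {b : ℝ → ℝ} (hf : Continuous f) (hb : Continuous b)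
    (h : ∀ᵐ x, ‖f x‖ ≤ b x) (x : ℝ) : ‖f x‖ ≤ b x := by
  have hd : Dense {x | ‖f x‖ ≤ b x} := Measure.dense_of_ae h
  have hc : IsClosed {x | ‖f x‖ ≤ b x} := isClosed_le hf.norm hb
  have := hd.closure_eq
  rw [hc.closure_eq] at this
  exact (this ▸ Set.mem_univ x : x ∈ {x | ‖f x‖ ≤ b x})

/-- For `y` in a bounded support, `Γ (x - y)` decays like `w(x)^{-k}` and `1/(x - y)` contributes a
full power of `|x|`, that is, four powers of the weight. -/
theorem exists_decay_step (hφ : LinearIndependent ℂ φ) (hΦ : ∀ j, Continuous (Φ j))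
    (hΦφ : ∀ j, Φ j =ᵐ[volume] φ j) {C : ℝ} (hC : ∀ x, |g x| ≤ C) (hΔ : Δ ≠ 0)
    (hK : ∀ᵐ x, ∀ᵐ y, ((x - y) * Δ : ℝ) * sumKernel (fun j => φ j) x y =
      Γ (x - y) * (g x - g y : ℝ)) {k : ℕ} {B : ℝ} (hB : ∀ s, ‖Γ s‖ * quarterWeight s ^ k ≤ B)
    (j : Fin N) : ∃ D, ∀ x, ‖Φ j x‖ * quarterWeight x ^ (k + 4) ≤ D := by
  -- Only the outer radius of the annulus matters here, so the centre is arbitrary.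
  obtain ⟨n, χ, h1, h2, h3⟩ := exists_diffQuotOp_eq hφ hΔ hK 0
  set R : ℝ := n + 1 with hR
  have hR1 : 1 ≤ R := by simp [hR]
  have hC0 : 0 ≤ C := (abs_nonneg _).trans (hC 0)
  have hB0 : 0 ≤ B := le_trans (by have := quarterWeight_pos 0; positivity) (hB 0)
  set E : ℝ := 4 * B * quarterWeight R ^ k * (2 * C / |Δ|) * ∫ y, ‖χ j y‖ with hE
  have hfar : ∀ x, 2 * R ≤ |x| → ‖diffQuotOp Γ g Δ (χ j) x‖ * quarterWeight x ^ (k + 4) ≤ E := by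
    intro x hx
    have hwx := quarterWeight_pos x
    have hwR := quarterWeight_pos R
    have hb : ∀ y, ‖Γ (x - y) * (g x - g y : ℝ) / ((x - y) * Δ : ℝ) * χ j y‖ ≤
        (B * quarterWeight R ^ k / quarterWeight x ^ k) * (2 * C / |Δ|) / (|x| / 2) * ‖χ j y‖ := by
      intro y
      rw [norm_mul]
      by_cases hy : χ j y = 0
      · simp [hy]
      have hyR : |y| ≤ R := by
        have : y ∈ annulus 0 n := by
          by_contra h
          exact hy (h2 j y h)
        simpa using this.2
      have hxy : |x| / 2 ≤ |x - y| := by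
        have := abs_sub_abs_le_abs_sub x y
        linarith
      have hΓxy : ‖Γ (x - y)‖ ≤ B * quarterWeight R ^ k / quarterWeight x ^ k := by
        rw [le_div_iff₀ (by positivity)]
        have e1 : quarterWeight x ≤ quarterWeight (x - y) * quarterWeight R := by
          have a := quarterWeight_add_le (x - y) y
          rw [sub_add_cancel] at a
          refine a.trans ?_
          have := quarterWeight_pos (x - y)
          gcongr
          exact quarterWeight_mono (by rwa [abs_of_pos (by linarith : 0 < R)])
        calc ‖Γ (x - y)‖ * quarterWeight x ^ k
            ≤ ‖Γ (x - y)‖ * (quarterWeight (x - y) * quarterWeight R) ^ k := by gcongr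
          _ = (‖Γ (x - y)‖ * quarterWeight (x - y) ^ k) * quarterWeight R ^ k := by
            rw [mul_pow]; ring
          _ ≤ B * quarterWeight R ^ k := by gcongr; exact hB _
      gcongr
      exact norm_diffQuot_le hΓxy hC (by linarith) hxy
    have hle : ‖diffQuotOp Γ g Δ (χ j) x‖ ≤
        (B * quarterWeight R ^ k / quarterWeight x ^ k) * (2 * C / |Δ|) / (|x| / 2) *
          ∫ y, ‖χ j y‖ := by
      rw [← integral_const_mul]
      exact norm_integral_le_of_norm_le ((h1 j).norm.const_mul _) (ae_of_all _ hb)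
    have hx0 : 0 < |x| := by linarith
    have hI0 : 0 ≤ ∫ y, ‖χ j y‖ := integral_nonneg fun y => norm_nonneg _
    calc ‖diffQuotOp Γ g Δ (χ j) x‖ * quarterWeight x ^ (k + 4)
        ≤ ((B * quarterWeight R ^ k / quarterWeight x ^ k) * (2 * C / |Δ|) / (|x| / 2) *
          ∫ y, ‖χ j y‖) * quarterWeight x ^ (k + 4) := by gcongr
      _ = (B * quarterWeight R ^ k * (2 * C / |Δ|) * ∫ y, ‖χ j y‖) *
          (2 * quarterWeight x ^ 4 / |x|) := by
        rw [pow_add]; field_simp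
      _ ≤ (B * quarterWeight R ^ k * (2 * C / |Δ|) * ∫ y, ‖χ j y‖) * 4 := by
        gcongr
        -- Since `|x| ≥ 2R ≥ 1`, `2 (1 + |x|) ≤ 4 |x|`.
        rw [quarterWeight_pow_four, div_le_iff₀ hx0]
        linarith
      _ = E := by rw [hE]; ring
  have hcont : Continuous fun x => ‖Φ j x‖ * quarterWeight x ^ (k + 4) :=
    (hΦ j).norm.mul (continuous_quarterWeight.pow _)
  obtain ⟨D, hD⟩ := (isCompact_Icc (a := -(2 * R)) (b := 2 * R)).exists_bound_of_continuousOn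
    hcont.continuousOn
  refine ⟨max D E, ?_⟩
  have hae : ∀ᵐ x, ‖Φ j x‖ ≤ max D E * (quarterWeight x ^ (k + 4))⁻¹ := by
    filter_upwards [h3 j, hΦφ j] with x a b
    rw [← div_eq_mul_inv, le_div_iff₀ (pow_pos (quarterWeight_pos x) _)]
    rcases le_total (2 * R) |x| with hx | hx
    · rw [b, a]
      exact (hfar x hx).trans (le_max_right _ _)
    · refine le_trans ?_ (le_max_left _ _)
      exact (le_abs_self _).trans (hD x (abs_le.1 hx))
  intro x
  have : ‖Φ j x‖ ≤ max D E * (quarterWeight x ^ (k + 4))⁻¹ := norm_le_of_ae_le (hΦ j) (continuous_const.mul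
    ((continuous_quarterWeight.pow (k + 4)).inv₀ fun x => (pow_pos (quarterWeight_pos x) _).ne'))
    hae x
  rwa [← div_eq_mul_inv, le_div_iff₀ (pow_pos (quarterWeight_pos x) _)] at this

/-- Each round raises `k` by one: `|φⱼ| ≤ D w^{-(k+4)}` bounds the new integrand by a multiple of
`w^{-6} = (1 + |x|)^{-3/2}`, which is integrable. With exponent `1/2` in the weight the same count
would give the non-integrable `(1 + |x|)^{-1}`. -/
theorem integrable_weight_density (hφ : LinearIndependent ℂ φ) (hΦ : ∀ j, Continuous (Φ j))
    (hΦφ : ∀ j, Φ j =ᵐ[volume] φ j) (hΓ : ∀ s, Γ s = ∫ x, sumKernel Φ (x + s) x)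
    {C : ℝ} (hC : ∀ x, |g x| ≤ C) (hΔ : Δ ≠ 0)
    (hK : ∀ᵐ x, ∀ᵐ y, ((x - y) * Δ : ℝ) * sumKernel (fun j => φ j) x y =
      Γ (x - y) * (g x - g y : ℝ)) (k : ℕ) :
    Integrable fun x => quarterWeight x ^ (2 * k) * density Φ x := by
  induction k with
  | zero =>
    simp only [mul_zero, pow_zero, one_mul]
    refine (integrable_density φ).congr ?_
    filter_upwards [ae_all_iff.2 hΦφ] with x hx
    simp [density, hx]
  | succ k ih =>
    choose D hD using exists_decay_step hφ hΦ hΦφ hC hΔ hK (norm_corr_le hΓ ih)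
    refine (integrable_quarterWeight_inv.const_mul (∑ j, D j ^ 2)).mono'
      ((continuous_quarterWeight.pow _).mul (continuous_density hΦ)).aestronglyMeasurable
      (ae_of_all _ fun x => ?_)
    have hw := quarterWeight_pos x
    rw [Real.norm_eq_abs, abs_of_nonneg (mul_nonneg (pow_nonneg hw.le _) (density_nonneg _ _)),
      ← div_eq_mul_inv, le_div_iff₀ (by positivity), density, Finset.mul_sum, Finset.sum_mul]
    refine Finset.sum_le_sum fun j _ => ?_
    calc quarterWeight x ^ (2 * (k + 1)) * ‖Φ j x‖ ^ 2 * quarterWeight x ^ 6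
        = (‖Φ j x‖ * quarterWeight x ^ (k + 4)) ^ 2 := by ring
      _ ≤ D j ^ 2 := by
        gcongr
        exact hD j x

theorem density_rapid_decay (hφ : LinearIndependent ℂ φ) (hΦ : ∀ j, Continuous (Φ j))
    (hΦφ : ∀ j, Φ j =ᵐ[volume] φ j) (hΓ : ∀ s, Γ s = ∫ x, sumKernel Φ (x + s) x)
    {C : ℝ} (hC : ∀ x, |g x| ≤ C) (hΔ : Δ ≠ 0)
    (hK : ∀ᵐ x, ∀ᵐ y, ((x - y) * Δ : ℝ) * sumKernel (fun j => φ j) x y =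
      Γ (x - y) * (g x - g y : ℝ)) (k : ℕ) :
    (∃ D, ∀ s, (1 + |s|) ^ k * ‖Γ s‖ ≤ D) ∧ ∃ D, ∀ x, (1 + |x|) ^ k * |density Φ x| ≤ D := by
  have hi := integrable_weight_density hφ hΦ hΦφ hΓ hC hΔ hK (4 * k)
  have hb := norm_corr_le hΓ hi
  refine ⟨⟨∫ x, quarterWeight x ^ (2 * (4 * k)) * density Φ x, fun s => ?_⟩, ?_⟩
  · have := hb s
    rwa [pow_mul, quarterWeight_pow_four, mul_comm] at this
  · choose D hD using exists_decay_step hφ hΦ hΦφ hC hΔ hK hb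
    refine ⟨∑ j, D j ^ 2, fun x => ?_⟩
    have hw := one_le_quarterWeight x
    rw [abs_of_nonneg (density_nonneg _ _), density, Finset.mul_sum]
    refine Finset.sum_le_sum fun j _ => ?_
    calc (1 + |x|) ^ k * ‖Φ j x‖ ^ 2 = quarterWeight x ^ (4 * k) * ‖Φ j x‖ ^ 2 := by
          rw [pow_mul, quarterWeight_pow_four]
      _ ≤ quarterWeight x ^ (2 * (4 * k + 4)) * ‖Φ j x‖ ^ 2 := by
          exact mul_le_mul_of_nonneg_right (pow_le_pow_right₀ hw (by omega)) (by positivity)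
      _ = (‖Φ j x‖ * quarterWeight x ^ (4 * k + 4)) ^ 2 := by ring
      _ ≤ D j ^ 2 := by
          have := quarterWeight_pos x
          gcongr
          exact hD j x

end decay

/-! ### From rapid decay on both Fourier sides to Schwartz functions. -/

/-- All the functions `(1 + |x|)^k u(x)` are bounded. -/
def RapidDecay (u : ℝ → ℂ) : Prop := ∀ k : ℕ, ∃ D, ∀ x, (1 + |x|) ^ k * ‖u x‖ ≤ D

theorem RapidDecay.integrable_pow_mul {u : ℝ → ℂ} (hu : Continuous u) (h : RapidDecay u) (k : ℕ) :
    Integrable fun x => x ^ k • u x := by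
  obtain ⟨D, hD⟩ := h (k + 2)
  have hi := integrable_one_add_norm (E := ℝ) (μ := volume) (r := 2) (by norm_num)
  refine (hi.const_mul D).mono' (by fun_prop) (ae_of_all _ fun x => ?_)
  have h1 : (0 : ℝ) < 1 + |x| := by positivity
  rw [Real.norm_eq_abs, Real.rpow_neg h1.le, ← div_eq_mul_inv, le_div_iff₀ (by positivity), norm_smul,
    norm_pow, Real.norm_eq_abs, show (2 : ℝ) = ((2 : ℕ) : ℝ) by norm_num, Real.rpow_natCast]
  calc |x| ^ k * ‖u x‖ * (1 + |x|) ^ 2 ≤ (1 + |x|) ^ k * ‖u x‖ * (1 + |x|) ^ 2 := by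
        gcongr; linarith
    _ = (1 + |x|) ^ (k + 2) * ‖u x‖ := by ring
    _ ≤ D := hD x

/-- Interpolation: Taylor's formula with step `δ` bounds `δ |u'(x)|` by values of `u` plus `M δ²`.
-/
theorem RapidDecay.deriv_of_bounded {u : ℝ → ℂ} (hu : RapidDecay u) (h1 : Differentiable ℝ u)
    (h2 : Differentiable ℝ (deriv u)) {M : ℝ} (hM : ∀ x, ‖deriv (deriv u) x‖ ≤ M) :
    RapidDecay (deriv u) := by
  intro m
  obtain ⟨D, hD⟩ := hu (2 * m)
  refine ⟨D * 4 ^ m + D + M, fun x => ?_⟩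
  set J := 1 + |x| with hJ
  have hJ1 : 1 ≤ J := by linarith [abs_nonneg x]
  have hJp : 0 < J := by linarith
  -- With this step, multiplying by `J^{2m}` turns `δ |u'|` into `J^m |u'|` and `M δ²` into `M`.
  set δ := (J ^ m)⁻¹ with hδ
  have hδ0 : 0 < δ := by positivity
  have hδ1 : δ ≤ 1 := inv_le_one_of_one_le₀ (one_le_pow₀ hJ1)
  have hD0 : 0 ≤ D := le_trans (by positivity) (hD 0)
  have hM0 : 0 ≤ M := (norm_nonneg _).trans (hM 0)
  have a1 : ∀ y ∈ Set.Icc x (x + δ), ‖deriv u y - deriv u x‖ ≤ M * δ := by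
    intro y hy
    have := Convex.norm_image_sub_le_of_norm_deriv_le (f := deriv u) (C := M) (s := Set.univ)
      (fun z _ => h2 z) (fun z _ => hM z) convex_univ (Set.mem_univ x) (Set.mem_univ y)
    refine this.trans ?_
    gcongr
    rw [Real.norm_eq_abs, abs_of_nonneg (by linarith [hy.1])]
    linarith [hy.2]
  have hw : ∀ y, HasDerivAt (fun y : ℝ => u y - (y : ℝ) • deriv u x) (deriv u y - deriv u x) y := by
    intro y
    have h := (hasDerivAt_id' y).smul_const (deriv u x)
    rw [one_smul] at h
    exact (h1 y).hasDerivAt.sub h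
  have a2 := Convex.norm_image_sub_le_of_norm_hasDerivWithin_le
    (f := fun y : ℝ => u y - (y : ℝ) • deriv u x) (C := M * δ) (s := Set.Icc x (x + δ))
    (fun y _ => (hw y).hasDerivWithinAt) a1 (convex_Icc _ _)
    (Set.left_mem_Icc.2 (by linarith)) (Set.right_mem_Icc.2 (by linarith))
  rw [add_sub_cancel_left, Real.norm_eq_abs, abs_of_pos hδ0] at a2
  have a3 : δ * ‖deriv u x‖ ≤ ‖u (x + δ)‖ + ‖u x‖ + M * δ * δ := by
    have e : δ • deriv u x = (u (x + δ) - u x) -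
        ((u (x + δ) - (x + δ) • deriv u x) - (u x - x • deriv u x)) := by
      rw [add_smul]; abel
    have : ‖δ • deriv u x‖ = δ * ‖deriv u x‖ := by
      rw [norm_smul, Real.norm_eq_abs, abs_of_pos hδ0]
    rw [← this, e]
    refine (norm_sub_le _ _).trans ?_
    gcongr
    exact norm_sub_le _ _
  have b1 : J ^ (2 * m) * ‖u x‖ ≤ D := hD x
  have b2 : J ^ (2 * m) * ‖u (x + δ)‖ ≤ D * 4 ^ m := by
    -- This holds because `δ ≤ 1`; its power `2m` is the source of `4 ^ m`.
    have hle : J ≤ 2 * (1 + |x + δ|) := by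
      have := abs_sub_abs_le_abs_sub x (x + δ)
      rw [sub_add_cancel_left, abs_neg, abs_of_pos hδ0] at this
      linarith [abs_nonneg (x + δ)]
    calc J ^ (2 * m) * ‖u (x + δ)‖ ≤ (2 * (1 + |x + δ|)) ^ (2 * m) * ‖u (x + δ)‖ := by gcongr
      _ = ((1 + |x + δ|) ^ (2 * m) * ‖u (x + δ)‖) * 4 ^ m := by
        rw [mul_pow, pow_mul 2]; norm_num; ring
      _ ≤ D * 4 ^ m := by gcongr; exact hD _
  have hJδ : J ^ m * δ = 1 := mul_inv_cancel₀ (by positivity)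
  have hJ2 : J ^ (2 * m) = J ^ m * J ^ m := by rw [two_mul, pow_add]
  calc J ^ m * ‖deriv u x‖ = J ^ (2 * m) * (δ * ‖deriv u x‖) := by
        rw [hJ2]; linear_combination (-(J ^ m * ‖deriv u x‖)) * hJδ
    _ ≤ J ^ (2 * m) * (‖u (x + δ)‖ + ‖u x‖ + M * δ * δ) := by gcongr
    _ = J ^ (2 * m) * ‖u (x + δ)‖ + J ^ (2 * m) * ‖u x‖ + M := by
        rw [hJ2]; linear_combination (M * (J ^ m * δ + 1)) * hJδ
    _ ≤ _ := by gcongr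

/-- Decay of `𝓕 h` makes `u = 𝓕 (𝓕 h)`, the reflection of `h`, smooth with all derivatives bounded.
Decay of `u` then passes to each derivative in turn by `RapidDecay.deriv_of_bounded`. -/
theorem exists_schwartz_of_rapidDecay {h : ℝ → ℂ} (hc : Continuous h) (h1 : RapidDecay h)
    (h2 : RapidDecay (𝓕 h)) : ∃ S : 𝓢(ℝ, ℂ), ∀ x, S x = h x := by
  have hi : Integrable h := by simpa using h1.integrable_pow_mul hc 0
  have hvc : Continuous (𝓕 h) := continuous_fourier hi
  have hvi := h2.integrable_pow_mul hvc
  have hvi0 : Integrable (𝓕 h) := by simpa using hvi 0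
  set u : ℝ → ℂ := 𝓕 (𝓕 h) with hu
  have hinv : ∀ x, u x = h (-x) := by
    intro x
    have := congrFun (hc.fourierInv_fourier_eq hi hvi0) (-x)
    rw [Real.fourierInv_eq_fourier_neg, neg_neg] at this
    exact this
  have hcd : ContDiff ℝ (⊤ : ℕ∞) u := by
    refine Real.contDiff_fourier fun n _ => ?_
    refine (hvi n).norm.congr (ae_of_all _ fun x => ?_)
    simp
  have hbd : ∀ n : ℕ, ∃ M, ∀ x, ‖iteratedDeriv n u x‖ ≤ M := by
    intro n
    refine ⟨∫ x : ℝ, ‖(-2 * Real.pi * Complex.I * x : ℂ) ^ n • 𝓕 h x‖, fun x => ?_⟩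
    rw [hu, Real.iteratedDeriv_fourier (N := ⊤) (fun n _ => hvi n) le_top]
    exact VectorFourier.norm_fourierIntegral_le_integral_norm _ _ _ _ _
  have hdiff : ∀ n : ℕ, Differentiable ℝ (iteratedDeriv n u) := fun n =>
    hcd.differentiable_iteratedDeriv n (by exact_mod_cast WithTop.coe_lt_top n)
  have hdecay : ∀ n : ℕ, RapidDecay (iteratedDeriv n u) := by
    intro n
    induction n with
    | zero =>
      intro k
      obtain ⟨D, hD⟩ := h1 k
      refine ⟨D, fun x => ?_⟩
      rw [iteratedDeriv_zero, hinv]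
      simpa using hD (-x)
    | succ n ih =>
      obtain ⟨M, hM⟩ := hbd (n + 2)
      rw [iteratedDeriv_succ]
      refine ih.deriv_of_bounded (hdiff n) ?_ (M := M) ?_
      · rw [← iteratedDeriv_succ]; exact hdiff _
      · rw [← iteratedDeriv_succ, ← iteratedDeriv_succ]; exact hM
  let T : 𝓢(ℝ, ℂ) :=
    { toFun := u
      smooth' := hcd
      decay' := by
        intro k n
        obtain ⟨D, hD⟩ := hdecay n k
        refine ⟨D, fun x => le_trans ?_ (hD x)⟩
        rw [norm_iteratedFDeriv_eq_norm_iteratedDeriv, Real.norm_eq_abs]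
        gcongr
        linarith }
  refine ⟨SchwartzMap.compCLMOfContinuousLinearEquiv ℝ (ContinuousLinearEquiv.neg ℝ) T, fun x => ?_⟩
  simp only [SchwartzMap.compCLMOfContinuousLinearEquiv_apply, Function.comp]
  change u (-x) = h x
  rw [hinv, neg_neg]

/-! ### Duality between the two symbols. -/

theorem FT2_fourierMul (F : ℝ → ℝ) (hF : MemLp F ∞ (volume : Measure ℝ)) (u : L2R) :
    FT2 (fourierMul F hF u) = funQ F hF (FT2 u) := by
  simp [fourierMul, funQ]

theorem memLp_top_neg_comp_neg {g : ℝ → ℝ} (hg : MemLp g ∞ (volume : Measure ℝ)) :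
    MemLp (fun x => -g (-x)) ∞ (volume : Measure ℝ) :=
  (hg.comp_measurePreserving (Measure.measurePreserving_neg volume)).neg

/-- The reflection comes from `FT2 ∘ FT2`. The sign is built in to compensate for the exchange of
the factors in the commutator. -/
theorem fourierMul_neg_comp_neg {g : ℝ → ℝ} (hg : MemLp g ∞ (volume : Measure ℝ)) (v : L2R) :
    fourierMul _ (memLp_top_neg_comp_neg hg) (FT2 v) = -FT2 (funQ g hg v) := by
  have h1 : mulOp (fun x => ((-g (-x) : ℝ) : ℂ)) (memLp_top_neg_comp_neg hg).ofReal (FT2 (FT2 v)) =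
      -FT2 (FT2 (funQ g hg v)) := by
    have hq := (Measure.measurePreserving_neg (volume : Measure ℝ)).quasiMeasurePreserving.ae
      (coeFn_mulOp (fun x => (g x : ℂ)) hg.ofReal v)
    apply Lp.ext
    filter_upwards [coeFn_mulOp (fun x => ((-g (-x) : ℝ) : ℂ)) (memLp_top_neg_comp_neg hg).ofReal
      (FT2 (FT2 v)), FT2_FT2_ae v, FT2_FT2_ae (funQ g hg v), Lp.coeFn_neg (FT2 (FT2 (funQ g hg v))), hq]
      with x a b c d e
    rw [d, Pi.neg_apply, c, a, b, funQ, e]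
    push_cast; ring
  apply FT2.injective
  rw [FT2_fourierMul, map_neg, ← h1]
  rfl

theorem IsCommRep.dual {N : ℕ} {F g : ℝ → ℝ} {hF : MemLp F ∞ (volume : Measure ℝ)}
    {hg : MemLp g ∞ (volume : Measure ℝ)} {φ : Fin N → L2R} (h : IsCommRep F g hF hg φ) :
    IsCommRep (fun x => -g (-x)) F (memLp_top_neg_comp_neg hg) hF (fun j => FT2 (φ j)) := by
  intro u
  obtain ⟨v, rfl⟩ := FT2.surjective u
  have h1 := congrArg FT2 (h v)
  rw [map_smul, map_sub, FT2_fourierMul, map_sum] at h1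
  simp only [map_smul] at h1
  rw [← FT2_fourierMul F hF v, fourierMul_neg_comp_neg hg, fourierMul_neg_comp_neg hg]
  simp only [FT2.inner_map_map]
  rw [← h1, map_neg, sub_neg_eq_add, neg_add_eq_sub]

theorem density_congr_ae {N : ℕ} {φ ψ : Fin N → ℝ → ℂ} (h : ∀ j, φ j =ᵐ[volume] ψ j) :
    density φ =ᵐ[volume] density ψ := by
  filter_upwards [ae_all_iff.2 h] with x hx
  simp [density, hx]

/-- Makes the decay of the dual correlation function a statement about the Fourier transform of the
density. -/
theorem corrFun_FT2 {N : ℕ} {φ : Fin N → L2R} {Φ : Fin N → ℝ → ℂ}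
    (hΦφ : ∀ j, Φ j =ᵐ[volume] φ j) (s : ℝ) :
    corrFun (fun j => FT2 (φ j)) s = 𝓕 (fun x => (density Φ x : ℂ)) s := by
  rw [corrFun, ← fourier_comp_neg (fun x => (density Φ x : ℂ))]
  apply Real.fourier_congr_ae
  have h1 := (Measure.measurePreserving_neg (volume : Measure ℝ)).quasiMeasurePreserving.ae
    (density_congr_ae hΦφ)
  filter_upwards [density_congr_ae (fun j => FT2_FT2_ae (φ j)), h1] with x a b
  rw [a, b]; rfl

/-! ### Regularity of one symbol. -/

theorem abs_le_of_primitive {κ : ℝ → ℝ} (hκ : Integrable κ) (h0 : ∀ x, 0 ≤ κ x) (G c x : ℝ) :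
    |G + c * ∫ t in Set.Iic x, κ t| ≤ |G| + |c| * ∫ t, κ t := by
  have h1 : 0 ≤ ∫ t in Set.Iic x, κ t := integral_nonneg h0
  have h2 : ∫ t in Set.Iic x, κ t ≤ ∫ t, κ t := setIntegral_le_integral hκ (ae_of_all _ h0)
  refine (abs_add_le _ _).trans ?_
  rw [abs_mul, abs_of_nonneg h1]
  gcongr

theorem hasDerivAt_integral_Iic {κ : ℝ → ℝ} (hκ : Integrable κ) (hc : Continuous κ) (x : ℝ) :
    HasDerivAt (fun x => ∫ t in Set.Iic x, κ t) (κ x) x := by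
  have h := (hc.integral_hasStrictDerivAt 0 x).hasDerivAt.const_add (∫ t in Set.Iic 0, κ t)
  refine h.congr_of_eventuallyEq (Eventually.of_forall fun y => ?_)
  have := intervalIntegral.integral_Iic_sub_Iic (a := 0) (b := y) hκ.integrableOn hκ.integrableOn
  simp only; linarith

theorem norm_corrFun_le {N : ℕ} (φ : Fin N → L2R) (s : ℝ) :
    ‖corrFun φ s‖ ≤ ∫ x, ‖(density (fun j => FT2 (φ j)) x : ℂ)‖ :=
  VectorFourier.norm_fourierIntegral_le_integral_norm _ _ _ _ _

theorem corrFun_zero_ne {N : ℕ} {φ : Fin N → L2R} {j : Fin N} (hj : φ j ≠ 0) : corrFun φ 0 ≠ 0 := by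
  rw [corrFun_eq_integral]
  simp only [add_zero, sumKernel_self]
  rw [integral_complex_ofReal]
  exact_mod_cast (integral_density_pos hj).ne'

/-- The regularity of `g` if `i[F(𝓕), g] = ∑ ⟨φⱼ, ·⟩ φⱼ`. -/
structure RegularRep {N : ℕ} (g : ℝ → ℝ) (φ : Fin N → L2R) (g₁ : ℝ → ℝ) (c gBot gTop : ℝ)
    (Φ : Fin N → ℝ → ℂ) : Prop where
  ae_eq : g₁ =ᵐ[volume] g
  ne_zero : c ≠ 0
  continuous : ∀ j, Continuous (Φ j)
  version : ∀ j, Φ j =ᵐ[volume] φ j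
  hasDerivAt : ∀ x, HasDerivAt g₁ (c * density Φ x) x
  bounded : ∃ C, ∀ x, |g₁ x| ≤ C
  tendsto_atBot : Tendsto g₁ atBot (𝓝 gBot)
  tendsto_atTop : Tendsto g₁ atTop (𝓝 gTop)
  jump : gTop - gBot = c * ∫ x, density (fun j => φ j) x
  jump_ne_zero : gTop - gBot ≠ 0
  pos : ∀ x, 0 < density Φ x
  corr_decay : RapidDecay (corrFun φ)
  density_decay : RapidDecay fun x => (density Φ x : ℂ)

theorem IsCommRep.exists_regularRep {N : ℕ} {F g : ℝ → ℝ} {hF : MemLp F ∞ (volume : Measure ℝ)}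
    {hg : MemLp g ∞ (volume : Measure ℝ)} {φ : Fin N → L2R} (h : IsCommRep F g hF hg φ)
    (hφ : LinearIndependent ℂ φ) (j₀ : Fin N) :
    ∃ g₁ c gBot gTop Φ, RegularRep g φ g₁ c gBot gTop Φ := by
  have hj : φ j₀ ≠ 0 := hφ.ne_zero j₀
  obtain ⟨G, c, hc, hG⟩ := h.exists_primitive hj
  set κ := density (fun j => φ j) with hκ
  have hκi : Integrable κ := integrable_density φ
  set g₁ : ℝ → ℝ := fun x => G + c * ∫ t in Set.Iic x, κ t with hg₁
  have hg₁c : Continuous g₁ := continuous_const.add (continuous_const.mul (continuous_integral_Iic hκi))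
  have hC := abs_le_of_primitive hκi (density_nonneg _) G c
  have hg₁m : MemLp g₁ ∞ (volume : Measure ℝ) :=
    memLp_top_of_bound hg₁c.aestronglyMeasurable _ (ae_of_all _ hC)
  have hae : g₁ =ᵐ[volume] g := by
    filter_upwards [hG] with x hx using hx.symm
  -- The kernel identity needs a continuous symbol with limits, so `g` is replaced by its primitive
  -- version.
  have h' := h.congr hF hg₁m (EventuallyEq.refl _ _) hae
  have hbot : Tendsto g₁ atBot (𝓝 (G + c * 0)) :=
    ((tendsto_integral_Iic_atBot hκi).const_mul c).const_add G
  have htop : Tendsto g₁ atTop (𝓝 (G + c * ∫ t, κ t)) :=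
    ((tendsto_integral_Iic_atTop hκi).const_mul c).const_add G
  have hΔ : (G + c * ∫ t, κ t) - (G + c * 0) ≠ 0 := by
    rw [mul_zero, add_zero, add_sub_cancel_left]
    exact mul_ne_zero hc (integral_density_pos hj).ne'
  have hK := h'.sumKernel_ae hg₁c hC hbot htop
  have hΓc := continuous_corrFun φ
  obtain ⟨Φ, hΦ⟩ := exists_continuous_version hφ hΓc (norm_corrFun_le φ) hg₁c hC hΔ hK
  have hΦc := fun j => (hΦ j).1
  have hΦφ := fun j => (hΦ j).2
  have hκΦ : density Φ =ᵐ[volume] κ := density_congr_ae hΦφ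
  have hder : ∀ x, HasDerivAt g₁ (c * density Φ x) x := by
    intro x
    have h1 := ((hasDerivAt_integral_Iic (hκi.congr hκΦ.symm) (continuous_density hΦc) x).const_mul
      c).const_add G
    refine h1.congr_of_eventuallyEq (Eventually.of_forall fun y => ?_)
    simp only [hg₁]
    rw [integral_congr_ae (ae_restrict_of_ae hκΦ)]
  have hKall := sumKernel_eq_of_ae hΦc hΦφ hΓc hg₁c hK
  have hne : ∃ x, density Φ x ≠ 0 := by
    by_contra! hcon
    exact hj (density_ae_eq_zero (hκΦ.symm.trans (ae_of_all _ hcon)) j₀)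
  have hcorr : ∀ s, corrFun φ s = ∫ x, sumKernel Φ (x + s) x := by
    intro s
    rw [corrFun_eq_integral]
    have hall := ae_all_iff.2 hΦφ
    have h1 := (measurePreserving_add_right (volume : Measure ℝ) s).quasiMeasurePreserving.ae hall
    apply integral_congr_ae
    filter_upwards [hall, h1] with x a b
    simp only [sumKernel, a, b]
  have hdec := density_rapid_decay hφ hΦc hΦφ hcorr hC hΔ hK
  refine ⟨g₁, c, _, _, Φ, ⟨hae, hc, hΦc, hΦφ, hder, ⟨_, hC⟩, hbot, htop, by ring, hΔ,
    density_pos hΦc hΓc (corrFun_zero_ne hj) hKall hc hder hne, fun k => (hdec k).1, fun k => ?_⟩⟩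
  simpa using (hdec k).2

theorem RegularRep.continuous_ofReal_density {N : ℕ} {g g₁ : ℝ → ℝ} {φ : Fin N → L2R} {c gBot gTop : ℝ}
    {Φ : Fin N → ℝ → ℂ} (h : RegularRep g φ g₁ c gBot gTop Φ) :
    Continuous fun x => (density Φ x : ℂ) :=
  Complex.continuous_ofReal.comp (continuous_density h.continuous)

theorem RegularRep.exists_schwartz {N : ℕ} {g g₁ : ℝ → ℝ} {φ : Fin N → L2R} {c gBot gTop : ℝ}
    {Φ : Fin N → ℝ → ℂ} (h : RegularRep g φ g₁ c gBot gTop Φ)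
    (hd : RapidDecay (𝓕 fun x => (density Φ x : ℂ))) :
    ∃ S : 𝓢(ℝ, ℝ), ∀ x, S x = c * density Φ x := by
  obtain ⟨S, hS⟩ := exists_schwartz_of_rapidDecay h.continuous_ofReal_density h.density_decay hd
  refine ⟨(c : ℝ) • SchwartzMap.postcompCLM (𝕜 := ℝ) Complex.reCLM S, fun x => ?_⟩
  simp [hS]

theorem RapidDecay.comp_neg {u : ℝ → ℂ} (h : RapidDecay u) : RapidDecay fun x => u (-x) := by
  intro k
  obtain ⟨D, hD⟩ := h k
  exact ⟨D, fun x => by simpa using hD (-x)⟩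

theorem RapidDecay.bounded {u : ℝ → ℂ} (h : RapidDecay u) : ∃ D, ∀ x, ‖u x‖ ≤ D := by
  simpa using h 0

/-! ### The constant `2π`. -/

/-- Differentiating `H(ξ) = ∫ F(w+ξ) W(w) dw` and taking Fourier transforms gives `-2πis 𝓕H(-s) = c'
Γ(s) 𝓕W(s)`. By `IsCommRep.cutoff_corrFun` the right side is `-i c' s (gTop - gBot) 𝓕H(-s)`. -/
theorem IsCommRep.mul_jump {N : ℕ} {F g : ℝ → ℝ} {hF : MemLp F ∞ (volume : Measure ℝ)}
    {hg : MemLp g ∞ (volume : Measure ℝ)} {φ : Fin N → L2R} (h : IsCommRep F g hF hg φ)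
    {c gBot gTop : ℝ} {Φ : Fin N → ℝ → ℂ} (hr : RegularRep g φ g c gBot gTop Φ)
    {c' fBot fTop : ℝ} {Ψ : Fin N → ℝ → ℂ}
    (hr' : RegularRep F (fun j => FT2 (φ j)) F c' fBot fTop Ψ) :
    c' * (gTop - gBot) = 2 * Real.pi := by
  have hgc : Continuous g := continuous_iff_continuousAt.2 fun x => (hr.hasDerivAt x).continuousAt
  obtain ⟨C, hC⟩ := hr.bounded
  have hpos : 0 < ∫ x in Set.Icc (0 : ℝ) 1, density (fun j => φ j) x := by
    have e : ∫ x in Set.Icc (0 : ℝ) 1, density (fun j => φ j) x =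
        ∫ x in Set.Icc (0 : ℝ) 1, density Φ x :=
      integral_congr_ae (ae_restrict_of_ae (density_congr_ae hr.version).symm)
    rw [e, integral_Icc_eq_integral_Ioc, ← intervalIntegral.integral_of_le zero_le_one]
    exact intervalIntegral.intervalIntegral_pos_of_pos
      ((continuous_density hr.continuous).intervalIntegrable _ _) hr.pos zero_lt_one
  -- A shift `s > 0` with `𝓕H(-s) ≠ 0` is needed for the final cancellation; it exists because the
  -- limit at `0+` is the positive mass of the density on `[0, 1]`.
  have hlim := tendsto_fourier_cutoffDensityFT_iccInd φ 0 1
  have hev := hlim.eventually_ne (Complex.ofReal_ne_zero.2 hpos.ne')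
  obtain ⟨s, hs, hs0⟩ := (hev.and self_mem_nhdsWithin).exists
  have hs0 : 0 < s := hs0
  set p := iccInd 0 1 with hp
  have hp1 := integrable_iccInd 0 1
  have hp2 := memLp_iccInd 0 1 2
  have hpi := memLp_iccInd 0 1 ∞
  set H := cutoffDensityFT φ p with hH
  have hHi : Integrable H := integrable_cutoffDensityFT hp2 hpi
  set W := wronskianFT (fun x => (p x : ℂ)) (fun x => (g x : ℂ) * p x) with hW
  have hg' : MemLp (fun x => (g x : ℂ)) ∞ (volume : Measure ℝ) := hg.ofReal
  have hWi : Integrable W := integrable_wronskianFT hp1 hp2 (integrable_const_mul_of_memLp_top hg' hp1)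
      (memLp_two_mul_of_memLp_top hg' hp2)
  have hHF : ∀ ξ, H ξ = ∫ w, (F (w + ξ) : ℂ) * W w := by
    intro ξ
    rw [← integral_sub_right_eq_self _ ξ]
    simp only [sub_add_cancel]
    exact h.sum_norm_sq_fourier hp1 hp2 ξ
  set k : ℝ → ℂ := fun x => (density Ψ x : ℂ) with hk
  have hkc : Continuous k := hr'.continuous_ofReal_density
  have hki : Integrable k := by simpa using hr'.density_decay.integrable_pow_mul hkc 0
  obtain ⟨D, hD⟩ := hr'.density_decay.bounded
  have hF0 : MemLp (fun x => (F x : ℂ)) ∞ (volume : Measure ℝ) := hF.ofReal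
  have hFc : Continuous fun x => (F x : ℂ) := Complex.continuous_ofReal.comp
    (continuous_iff_continuousAt.2 fun x => (hr'.hasDerivAt x).continuousAt)
  have hder : ∀ ξ, HasDerivAt H (c' * ∫ w, k (w + ξ) * W w) ξ := by
    intro ξ
    have := (hasDerivAt_integral_of_dominated_loc_of_deriv_le (μ := volume) (x₀ := ξ) (s := Set.univ)
      (F := fun ξ w => (F (w + ξ) : ℂ) * W w) (F' := fun ξ w => (c' * k (w + ξ)) * W w)
      (bound := fun w => (|c'| * D) * ‖W w‖) univ_mem ?_ ?_ ?_ ?_ (hWi.norm.const_mul _) ?_).2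
    · simp_rw [mul_assoc] at this
      rw [integral_const_mul] at this
      exact this.congr_of_eventuallyEq (Eventually.of_forall hHF)
    · exact Eventually.of_forall fun x => AEStronglyMeasurable.mul
        (hFc.comp (continuous_add_const x)).aestronglyMeasurable hWi.1
    · exact integrable_const_mul_of_memLp_top
        (hF0.comp_measurePreserving (measurePreserving_add_right volume ξ)) hWi
    · refine AEStronglyMeasurable.mul (Continuous.aestronglyMeasurable ?_) hWi.1
      fun_prop
    · refine ae_of_all _ fun w x _ => ?_
      rw [norm_mul, norm_mul, Complex.norm_real, Real.norm_eq_abs]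
      gcongr
      exact hD _
    · refine ae_of_all _ fun w x _ => ?_
      have h1 := ((hr'.hasDerivAt (w + x)).ofReal_comp).comp_const_add w x
      have h2 := h1.mul_const (W w)
      simpa [hk] using h2
  have hcorr : ∀ ξ, ∫ w, k (w + ξ) * W w = ∫ w, k w * W (w - ξ) := by
    intro ξ
    rw [← integral_sub_right_eq_self _ ξ]
    simp only [sub_add_cancel]
  simp_rw [hcorr] at hder
  have hconv : Integrable fun ξ => ∫ w, k w * W (w - ξ) := by
    have := hki.integrable_convolution (ContinuousLinearMap.mul ℂ ℂ) hWi.comp_neg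
    refine this.congr (ae_of_all _ fun ξ => ?_)
    simp [convolution]
  have hderiv : deriv H = fun ξ => c' * ∫ w, k w * W (w - ξ) := funext fun ξ => (hder ξ).deriv
  have hfd := Real.fourier_deriv hHi (fun ξ => (hder ξ).differentiableAt)
    (by rw [hderiv]; exact hconv.const_mul _)
  have hfd := congrFun hfd (-s)
  have hΓ : 𝓕 k (-s) = corrFun φ s := by
    rw [corrFun]
    apply Real.fourier_congr_ae
    filter_upwards [density_congr_ae hr'.version] with x hx
    rw [hk]; simp only [hx]
  have hlhs : 𝓕 (deriv H) (-s) = c' * (corrFun φ s * 𝓕 W s) := by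
    rw [← hΓ, ← fourier_correlation hki hWi, hderiv, Real.fourier_real_eq, Real.fourier_real_eq,
      ← integral_const_mul]
    congr 1; ext ξ
    simp only [Circle.smul_def, smul_eq_mul]; ring
  rw [hlhs, fourier_wronskianFT hg hp1 hp2] at hfd
  have hratio := h.cutoff_corrFun hgc hC hr.tendsto_atBot hr.tendsto_atTop hs0.le 0 1
  have key : (((c' * (gTop - gBot) - 2 * Real.pi) : ℝ) : ℂ) * ((s : ℂ) * 𝓕 H (-s)) = 0 := by
    simp only [smul_eq_mul] at hfd
    push_cast at hfd hratio ⊢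
    linear_combination c' * hratio + Complex.I * hfd + (c' * corrFun φ s *
      ((∫ x, p x * p (x + s) * (g (x + s) - g x) : ℝ) : ℂ) -
        2 * Real.pi * s * 𝓕 H (-s)) * Complex.I_sq
  have hne : (s : ℂ) * 𝓕 H (-s) ≠ 0 := mul_ne_zero (by exact_mod_cast hs0.ne') hs
  have := (mul_eq_zero.1 key).resolve_right hne
  have h2 : c' * (gTop - gBot) - 2 * Real.pi = 0 := by exact_mod_cast this
  linarith

theorem integral_density_FT2 {N : ℕ} (φ : Fin N → L2R) :
    ∫ x, density (fun j => FT2 (φ j)) x = ∫ x, density (fun j => φ j) x := by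
  have h : ∀ ψ : Fin N → L2R, ∫ x, density (fun j => ψ j) x = ∑ j, ‖ψ j‖ ^ 2 := by
    intro ψ
    simp only [density]
    rw [integral_finsetSum _ fun j _ => integrable_norm_sq (Lp.memLp (ψ j))]
    simp only [norm_sq_L2R]
  rw [h, h]
  simp

theorem RegularRep.continuous_fun {N : ℕ} {g g₁ : ℝ → ℝ} {φ : Fin N → L2R} {c gBot gTop : ℝ}
    {Φ : Fin N → ℝ → ℂ} (h : RegularRep g φ g₁ c gBot gTop Φ) : Continuous g₁ :=
  continuous_iff_continuousAt.2 fun x => (h.hasDerivAt x).continuousAt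

theorem RegularRep.memLp {N : ℕ} {g g₁ : ℝ → ℝ} {φ : Fin N → L2R} {c gBot gTop : ℝ}
    {Φ : Fin N → ℝ → ℂ} (h : RegularRep g φ g₁ c gBot gTop Φ) : MemLp g₁ ∞ (volume : Measure ℝ) := by
  obtain ⟨C, hC⟩ := h.bounded
  exact memLp_top_of_bound h.continuous_fun.aestronglyMeasurable C (ae_of_all _ hC)

theorem RegularRep.self {N : ℕ} {g g₁ : ℝ → ℝ} {φ : Fin N → L2R} {c gBot gTop : ℝ}
    {Φ : Fin N → ℝ → ℂ} (h : RegularRep g φ g₁ c gBot gTop Φ) : RegularRep g₁ φ g₁ c gBot gTop Φ :=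
  { h with ae_eq := EventuallyEq.refl _ _ }

/-- Each density is Schwartz because its Fourier transform is, up to reflection, the correlation
function of the other side. One constant comes from `IsCommRep.mul_jump`; the other equals it
because both densities have the same integral, by Plancherel. -/
theorem IsCommRep.exists_regularRep_pair {N : ℕ} {F g : ℝ → ℝ} {hF : MemLp F ∞ (volume : Measure ℝ)}
    {hg : MemLp g ∞ (volume : Measure ℝ)} {φ : Fin N → L2R} (h : IsCommRep F g hF hg φ)
    (hφ : LinearIndependent ℂ φ) (j₀ : Fin N) :
    ∃ g₁ c gBot gTop Φ F₁ d fBot fTop Ψ, RegularRep g φ g₁ c gBot gTop Φ ∧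
      RegularRep F (fun j => FT2 (φ j)) F₁ d fBot fTop Ψ ∧
      c * (fTop - fBot) = 2 * Real.pi ∧ d * (gTop - gBot) = 2 * Real.pi ∧
      (∃ S : 𝓢(ℝ, ℝ), ∀ x, S x = c * density Φ x) ∧
      (∃ S : 𝓢(ℝ, ℝ), ∀ x, S x = d * density Ψ x) := by
  obtain ⟨g₁, c, gBot, gTop, Φ, hr⟩ := h.exists_regularRep hφ j₀
  have hφ' : LinearIndependent ℂ fun j => FT2 (φ j) :=
    hφ.map' FT2.toLinearEquiv.toLinearMap (LinearEquiv.ker _)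
  obtain ⟨F₁, d, fBot, fTop, Ψ, hr'⟩ := h.dual.exists_regularRep hφ' j₀
  have h' := h.congr hr'.memLp hr.memLp hr'.ae_eq hr.ae_eq
  have hd := h'.mul_jump hr.self hr'.self
  have hc : c * (fTop - fBot) = d * (gTop - gBot) := by
    rw [hr.jump, hr'.jump, integral_density_FT2]; ring
  refine ⟨g₁, c, gBot, gTop, Φ, F₁, d, fBot, fTop, Ψ, hr, hr', hc.trans hd, hd,
    hr.exists_schwartz ?_, hr'.exists_schwartz ?_⟩
  · have := hr'.corr_decay
    rwa [show corrFun (fun j => FT2 (φ j)) = 𝓕 (fun x => (density Φ x : ℂ)) from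
      funext fun s => corrFun_FT2 hr.version s] at this
  · have := hr.corr_decay.comp_neg
    rwa [show (fun s => corrFun φ (-s)) = 𝓕 (fun x => (density Ψ x : ℂ)) from ?_] at this
    funext s
    rw [corrFun, neg_neg]
    apply Real.fourier_congr_ae
    filter_upwards [density_congr_ae hr'.version] with x hx
    rw [hx]

/-! ### Positive finite-rank operators and their kernels. -/

theorem integral_sum_kernel_mul {N : ℕ} (φ : Fin N → L2R) (ψ : L2R) (x : ℝ) :
    Integrable (fun y => (∑ j, φ j x * conj (φ j y)) * ψ y) ∧
      ∫ y, (∑ j, φ j x * conj (φ j y)) * ψ y = ∑ j, inner ℂ (φ j) ψ * φ j x := by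
  have hi := fun j => integrable_conj_mul (Lp.memLp (φ j)) (Lp.memLp ψ)
  have e : (fun y => (∑ j, φ j x * conj (φ j y)) * ψ y) =
      fun y => ∑ j, φ j x * (conj (φ j y) * ψ y) := by
    funext y
    rw [Finset.sum_mul]
    exact Finset.sum_congr rfl fun j _ => mul_assoc _ _ _
  rw [e]
  refine ⟨integrable_finsetSum _ fun j _ => (hi j).const_mul _, ?_⟩
  rw [integral_finsetSum _ fun j _ => (hi j).const_mul _]
  refine Finset.sum_congr rfl fun j _ => ?_
  rw [integral_const_mul, inner_L2R, mul_comm]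

theorem coeFn_sum_inner_smul {N : ℕ} (φ : Fin N → L2R) (ψ : L2R) :
    (∑ j, inner ℂ (φ j) ψ • φ j : L2R) =ᵐ[volume] fun x => ∑ j, inner ℂ (φ j) ψ * φ j x := by
  have h1 := Lp.coeFn_finsetSum Finset.univ (fun j => (inner ℂ (φ j) ψ • φ j : L2R))
  have h2 : ∀ᵐ x, ∀ j, (inner ℂ (φ j) ψ • φ j : L2R) x = inner ℂ (φ j) ψ * φ j x :=
    ae_all_iff.2 fun j => Lp.coeFn_smul _ _
  filter_upwards [h1, h2] with x a b
  rw [a]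
  simp [b]

theorem hasIntegralKernel_sum_iff {N : ℕ} (T : L2R →L[ℂ] L2R) (φ : Fin N → L2R) :
    HasIntegralKernel T (fun x y => ∑ j, φ j x * conj (φ j y)) ↔
      ∀ u, T u = ∑ j, inner ℂ (φ j) u • φ j := by
  constructor
  · intro h u
    apply Lp.ext
    filter_upwards [(h u).2, coeFn_sum_inner_smul φ u] with x a b
    rw [a, b, (integral_sum_kernel_mul φ u x).2]
  · intro h u
    refine ⟨ae_of_all _ fun x => (integral_sum_kernel_mul φ u x).1, ?_⟩
    filter_upwards [coeFn_sum_inner_smul φ u] with x b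
    rw [h, b, (integral_sum_kernel_mul φ u x).2]

/-- The spectral theorem on the finite-dimensional invariant range: the functions are eigenvectors
scaled by the square roots of their eigenvalues. -/
theorem exists_rankOne_sum {H : Type*} [NormedAddCommGroup H] [InnerProductSpace ℂ H]
    [CompleteSpace H] {T : H →L[ℂ] H}
    (hpos : T.IsPositive) (hfin : FiniteDimensional ℂ T.range) :
    ∃ (N : ℕ) (φ : Fin N → H), LinearIndependent ℂ φ ∧ ∀ u, T u = ∑ j, inner ℂ (φ j) u • φ j := by
  have hsymm : ∀ x y, inner ℂ (T x) y = inner ℂ x (T y) := fun x y => hpos.isSymmetric x y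
  let S : T.range →ₗ[ℂ] T.range := (T : H →ₗ[ℂ] H).restrict (fun x _ => ⟨x, rfl⟩)
  have hS : S.IsSymmetric := fun x y => hsymm x y
  set e := hS.eigenvectorBasis rfl with he
  set ev := hS.eigenvalues rfl with hev
  have hTe : ∀ i, T (e i : H) = (ev i : ℂ) • (e i : H) := fun i =>
    congrArg Subtype.val (hS.apply_eigenvectorBasis rfl i)
  have hnorm : ∀ i, inner ℂ (e i : H) (e i : H) = (1 : ℂ) := fun i => by
    have : ‖(e i : H)‖ = 1 := e.orthonormal.1 i
    rw [inner_self_eq_norm_sq_to_K, this]; simp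
  have hev0 : ∀ i, 0 ≤ ev i := by
    intro i
    have h1 := hpos.re_inner_nonneg_right (e i : H)
    rw [hTe, inner_smul_right, hnorm, mul_one] at h1
    simpa using h1
  -- An eigenvector `e i = T w` with eigenvalue `0` would satisfy `⟨e i, e i⟩ = ⟨T (e i), w⟩ = 0`.
  have hevne : ∀ i, ev i ≠ 0 := by
    intro i h0
    obtain ⟨w, hw⟩ := (e i).2
    have h1 : inner ℂ (e i : H) (e i : H) = (0 : ℂ) := by
      have h2 := hsymm (e i : H) w
      rw [hTe, h0] at h2
      have hw' : T w = (e i : H) := hw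
      rw [hw'] at h2
      simpa using h2.symm
    rw [hnorm] at h1
    exact one_ne_zero h1
  refine ⟨_, fun i => ((Real.sqrt (ev i) : ℝ) : ℂ) • (e i : H), ?_, fun u => ?_⟩
  · have h1 : LinearIndependent ℂ fun i => (e i : H) :=
      e.orthonormal.linearIndependent.map' (Submodule.subtype _) (Submodule.ker_subtype _)
    have hne : ∀ i, ((Real.sqrt (ev i) : ℝ) : ℂ) ≠ 0 := fun i =>
      Complex.ofReal_ne_zero.2 (Real.sqrt_ne_zero'.2 (lt_of_le_of_ne (hev0 i) (hevne i).symm))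
    exact h1.units_smul (fun i => Units.mk0 _ (hne i))
  · have h1 := congrArg Subtype.val (e.sum_repr' ⟨T u, ⟨u, rfl⟩⟩)
    simp only [AddSubmonoidClass.coe_finsetSum, Submodule.coe_smul, Submodule.coe_inner] at h1
    rw [← h1]
    refine Finset.sum_congr rfl fun i _ => ?_
    rw [← hsymm, hTe, inner_smul_left, inner_smul_left, Complex.conj_ofReal, Complex.conj_ofReal,
      smul_smul]
    congr 1
    have : ((Real.sqrt (ev i) : ℝ) : ℂ) * ((Real.sqrt (ev i) : ℝ) : ℂ) = (ev i : ℂ) := by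
      rw [← Complex.ofReal_mul, Real.mul_self_sqrt (hev0 i)]
    rw [← this]; ring

/-! ### Rescaling by `2π` and conclusion. -/

theorem memLp_top_dilate_real {f : ℝ → ℝ} (hf : MemLp f ∞ (volume : Measure ℝ)) :
    MemLp (fun w : ℝ => f (2 * Real.pi * w)) ∞ (volume : Measure ℝ) := by
  have h2 : (2 * Real.pi : ℝ) ≠ 0 := by positivity
  have h : MemLp f ∞ (Measure.map (fun w : ℝ => 2 * Real.pi * w) volume) := by
    rw [Real.map_volume_mul_left h2]
    exact hf.smul_measure ENNReal.ofReal_ne_top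
  exact h.comp_of_map (by fun_prop)

theorem isCommRep_of_commPQ {f g : ℝ → ℝ} {hf : MemLp f ∞ (volume : Measure ℝ)}
    {hg : MemLp g ∞ (volume : Measure ℝ)} {N : ℕ} {φ : Fin N → L2R}
    (h : ∀ u, commPQ f g hf hg u = ∑ j, inner ℂ (φ j) u • φ j) :
    IsCommRep (fun w : ℝ => f (2 * Real.pi * w)) g (memLp_top_dilate_real hf) hg φ :=
  fun u => h u

theorem quasiMeasurePreserving_div_two_pi :
    Measure.QuasiMeasurePreserving (fun x : ℝ => x / (2 * Real.pi)) volume volume := by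
  refine ⟨by fun_prop, ?_⟩
  have h2 : (2 * Real.pi)⁻¹ ≠ 0 := by positivity
  simp_rw [div_eq_mul_inv]
  rw [Real.map_volume_mul_right h2]
  exact Measure.smul_absolutelyContinuous

theorem ae_eq_comp_div {f F₁ : ℝ → ℝ}
    (h : F₁ =ᵐ[volume] fun w => f (2 * Real.pi * w)) :
    (fun x => F₁ (x / (2 * Real.pi))) =ᵐ[volume] f := by
  filter_upwards [quasiMeasurePreserving_div_two_pi.ae h] with x hx
  rw [hx]
  congr 1
  field_simp

theorem contDiff_one_of_hasDerivAt {g g' : ℝ → ℝ} (h : ∀ x, HasDerivAt g (g' x) x)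
    (hc : Continuous g') : ContDiff ℝ 1 g := by
  rw [contDiff_one_iff_deriv]
  refine ⟨fun x => (h x).differentiableAt, ?_⟩
  rwa [funext fun x => (h x).deriv]

theorem RegularRep.contDiff {N : ℕ} {g g₁ : ℝ → ℝ} {φ : Fin N → L2R} {c gBot gTop : ℝ}
    {Φ : Fin N → ℝ → ℂ} (h : RegularRep g φ g₁ c gBot gTop Φ) : ContDiff ℝ 1 g₁ :=
  contDiff_one_of_hasDerivAt h.hasDerivAt (continuous_const.mul (continuous_density h.continuous))

theorem hasDerivAt_comp_div_two_pi {F : ℝ → ℝ} {F' x : ℝ}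
    (h : HasDerivAt F F' (x / (2 * Real.pi))) :
    HasDerivAt (fun x => F (x / (2 * Real.pi))) (F' / (2 * Real.pi)) x := by
  rw [← mul_one_div]
  exact h.comp x ((hasDerivAt_id' x).div_const (2 * Real.pi))

theorem ae_eq_unitaryFT {φ : L2R} {Ψ : ℝ → ℂ} (h : Ψ =ᵐ[volume] FT2 φ) :
    (fun ξ => ((Real.sqrt (2 * Real.pi))⁻¹ : ℝ) * Ψ (ξ / (2 * Real.pi))) =ᵐ[volume] unitaryFT φ := by
  filter_upwards [quasiMeasurePreserving_div_two_pi.ae h] with x hx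
  rw [hx, unitaryFT]

theorem sum_norm_sq_unitary {N : ℕ} (Ψ : Fin N → ℝ → ℂ) (ξ : ℝ) :
    ∑ j, ‖(((Real.sqrt (2 * Real.pi))⁻¹ : ℝ) : ℂ) * Ψ j (ξ / (2 * Real.pi))‖ ^ 2 =
      density Ψ (ξ / (2 * Real.pi)) / (2 * Real.pi) := by
  rw [density, Finset.sum_div]
  refine Finset.sum_congr rfl fun j _ => ?_
  rw [norm_mul, mul_pow, Complex.norm_real, Real.norm_eq_abs, sq_abs, inv_pow,
    Real.sq_sqrt (by positivity)]
  ring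

theorem mainTheorem7 (f g : ℝ → ℝ)
    (hf : MemLp f ∞ (volume : Measure ℝ)) (hg : MemLp g ∞ (volume : Measure ℝ))
    (hpos : (commPQ f g hf hg).IsPositive)
    (hne : commPQ f g hf hg ≠ 0)
    (hfin : FiniteDimensional ℂ (commPQ f g hf hg).range) :
    ∃ f₁ g₁ : ℝ → ℝ, f₁ =ᵐ[volume] f ∧ g₁ =ᵐ[volume] g ∧
      ContDiff ℝ 1 f₁ ∧ ContDiff ℝ 1 g₁ ∧
      (∀ x, deriv f₁ x ≠ 0) ∧ (∀ x, deriv g₁ x ≠ 0) ∧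
      (∃ F : 𝓢(ℝ, ℝ), ∀ x, deriv f₁ x = F x) ∧
      (∃ G : 𝓢(ℝ, ℝ), ∀ x, deriv g₁ x = G x) ∧
      (∃ (N : ℕ) (φ : Fin N → L2R), LinearIndependent ℂ φ ∧
        HasIntegralKernel (commPQ f g hf hg) (fun x y => ∑ j, φ j x * conj (φ j y))) ∧
      ∃ fBot fTop gBot gTop : ℝ,
        Tendsto f₁ atBot (𝓝 fBot) ∧ Tendsto f₁ atTop (𝓝 fTop) ∧
        Tendsto g₁ atBot (𝓝 gBot) ∧ Tendsto g₁ atTop (𝓝 gTop) ∧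
        fTop - fBot ≠ 0 ∧ gTop - gBot ≠ 0 ∧
        ∀ (N : ℕ) (φ : Fin N → L2R), LinearIndependent ℂ φ →
          HasIntegralKernel (commPQ f g hf hg) (fun x y => ∑ j, φ j x * conj (φ j y)) →
          ∃ Φ Ψ : Fin N → ℝ → ℂ,
            (∀ j, Continuous (Φ j) ∧ Φ j =ᵐ[volume] φ j) ∧
            (∀ j, Continuous (Ψ j) ∧ Ψ j =ᵐ[volume] unitaryFT (φ j)) ∧
            (∀ x, deriv g₁ x = 2 * Real.pi * (∑ j, ‖Φ j x‖ ^ 2) / (fTop - fBot)) ∧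
            (∀ ξ, deriv f₁ ξ = 2 * Real.pi * (∑ j, ‖Ψ j ξ‖ ^ 2) / (gTop - gBot)) := by

  have hpi : 0 < 2 * Real.pi := by positivity
  have hindex : ∀ {N : ℕ} {φ : Fin N → L2R},
      (∀ u, commPQ f g hf hg u = ∑ j, inner ℂ (φ j) u • φ j) → Nonempty (Fin N) := by
    intro N φ h
    by_contra hN
    rw [not_nonempty_iff] at hN
    refine hne (ContinuousLinearMap.ext fun u => ?_)
    rw [h u]; simp
  obtain ⟨N₀, φ₀, hφ₀, hT₀⟩ := exists_rankOne_sum hpos hfin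
  obtain ⟨j₀⟩ := hindex hT₀
  obtain ⟨g₁, c, gBot, gTop, Φ₀, F₁, d, fBot, fTop, Ψ₀, hr, hr', hc, hd, ⟨G, hG⟩, ⟨S, hS⟩⟩ :=
    (isCommRep_of_commPQ hT₀).exists_regularRep_pair hφ₀ j₀
  set f₁ : ℝ → ℝ := fun x => F₁ (x / (2 * Real.pi)) with hf₁
  have hf₁d : ∀ x, HasDerivAt f₁ (d * density Ψ₀ (x / (2 * Real.pi)) / (2 * Real.pi)) x :=
    fun x => hasDerivAt_comp_div_two_pi (hr'.hasDerivAt _)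
  refine ⟨f₁, g₁, ae_eq_comp_div hr'.ae_eq, hr.ae_eq, ?_, hr.contDiff, ?_, ?_, ?_, ?_, ?_, ?_⟩
  · exact hr'.contDiff.comp (contDiff_id.div_const _)
  · intro x
    rw [(hf₁d x).deriv]
    exact div_ne_zero (mul_ne_zero hr'.ne_zero (hr'.pos _).ne') hpi.ne'
  · intro x
    rw [(hr.hasDerivAt x).deriv]
    exact mul_ne_zero hr.ne_zero (hr.pos _).ne'
  · refine ⟨(2 * Real.pi)⁻¹ • SchwartzMap.compCLMOfContinuousLinearEquiv ℝ
      (ContinuousLinearEquiv.smulLeft (Units.mk0 (2 * Real.pi)⁻¹ (inv_ne_zero hpi.ne'))) S, fun x => ?_⟩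
    rw [(hf₁d x).deriv, ← hS]
    simp only [smul_apply, SchwartzMap.compCLMOfContinuousLinearEquiv_apply,
      Function.comp, smul_eq_mul]
    have : (ContinuousLinearEquiv.smulLeft (Units.mk0 (2 * Real.pi)⁻¹ (inv_ne_zero hpi.ne')) :
        ℝ ≃L[ℝ] ℝ) x = x / (2 * Real.pi) := by
      rw [div_eq_inv_mul]; rfl
    rw [this, div_eq_inv_mul]
  · exact ⟨G, fun x => by rw [(hr.hasDerivAt x).deriv, hG]⟩
  · exact ⟨N₀, φ₀, hφ₀, (hasIntegralKernel_sum_iff _ _).2 hT₀⟩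
  · have hbot : Tendsto f₁ atBot (𝓝 fBot) :=
      hr'.tendsto_atBot.comp (tendsto_id.atBot_div_const hpi)
    have htop : Tendsto f₁ atTop (𝓝 fTop) :=
      hr'.tendsto_atTop.comp (tendsto_id.atTop_div_const hpi)
    refine ⟨fBot, fTop, gBot, gTop, hbot, htop, hr.tendsto_atBot, hr.tendsto_atTop,
      hr'.jump_ne_zero, hr.jump_ne_zero, fun N φ hφ hker => ?_⟩
    have hT := (hasIntegralKernel_sum_iff _ _).1 hker
    obtain ⟨j⟩ := hindex hT
    obtain ⟨g₂, c₂, gBot₂, gTop₂, Φ, F₂, d₂, fBot₂, fTop₂, Ψ, hs, hs', hc₂, hd₂, -, -⟩ :=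
      (isCommRep_of_commPQ hT).exists_regularRep_pair hφ j
    -- Any other representation gives continuous versions of the same `f` and `g`; they coincide
    -- everywhere with those already chosen, and so do the limits.
    obtain rfl : g₂ = g₁ := (hs.continuous_fun.ae_eq_iff_eq volume hr.continuous_fun).1
      (hs.ae_eq.trans hr.ae_eq.symm)
    obtain rfl : F₂ = F₁ := (hs'.continuous_fun.ae_eq_iff_eq volume hr'.continuous_fun).1
      (hs'.ae_eq.trans hr'.ae_eq.symm)
    obtain rfl := tendsto_nhds_unique hs.tendsto_atBot hr.tendsto_atBot
    obtain rfl := tendsto_nhds_unique hs.tendsto_atTop hr.tendsto_atTop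
    obtain rfl := tendsto_nhds_unique hs'.tendsto_atBot hr'.tendsto_atBot
    obtain rfl := tendsto_nhds_unique hs'.tendsto_atTop hr'.tendsto_atTop
    refine ⟨Φ, fun j ξ => ((Real.sqrt (2 * Real.pi))⁻¹ : ℝ) * Ψ j (ξ / (2 * Real.pi)),
      fun j => ⟨hs.continuous j, hs.version j⟩, fun j => ⟨?_, ae_eq_unitaryFT (hs'.version j)⟩,
      fun x => ?_, fun ξ => ?_⟩
    · exact continuous_const.mul ((hs'.continuous j).comp (continuous_id.div_const _))
    · rw [(hs.hasDerivAt x).deriv, ← hc₂, eq_div_iff hs'.jump_ne_zero, density]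
      ring
    · rw [(hasDerivAt_comp_div_two_pi (hs'.hasDerivAt _)).deriv, sum_norm_sq_unitary, ← hd₂,
        eq_div_iff hs.jump_ne_zero, hd₂]
      field_simp
      rw [← hd₂]; ring
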